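/- Let $M$ be a compact connected Riemannian manifold with Riemannian distance $d_1$, let $(K,d_2)$ be a non-empty compact metric space, $\Sigma=M\times K$, and fix $\zeta\in(0,1]$. For a function $h$ on a metric space let $H_\zeta(h)=\sup_{x\ne y}|h(x)-h(y)|/d(x,y)^\zeta$. Let $F:\Sigma\to\Sigma$, $F(x,z)=(f(x),G(x,z))$, with $G:\Sigma\to K$ measurable and $f:M\to M$ a local diffeomorphism of degree $\deg(f)=\#f^{-1}(x)$. Let $m_1$ be an $f$-invariant Borel probability on $M$ such that $f$ has a Jacobian $J\ge 0$ with respect to $m_1$, i.e. $m_1(f(B))=\int_B J\,dm_1$ for every Borel set $B$ on which $f$ is injective, and put $\rho=1/|J|$. Let $x\mapsto L(x)$ be a continuous real function on $M$ such that every $x$ has a neighbourhood $U_x$ on which $f$ is injective and whose inverse branch satisfies $d_1(f_x^{-1}(y),f_x^{-1}(z))\le L(x)\,d_1(y,z)$ for $y,z\in f(U_x)$. Assume that there are an open set $\mathcal A\subset M$, constants $\sigma>1$, $1\le L\le 2$, $\epsilon_\rho>0$ and an integer $q\ge 0$ such that (f1) $L(x)\le L$ for $x\in\mathcal A$ and $L(x)<\sigma^{-1}$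 for $x\notin\mathcal A$; (f2) $M$ has a finite covering by open sets on each of which $f$ is injective, and $\mathcal A$ is covered by $q<\deg(f)$ of these sets; (f3) $\sup\log\rho-\inf\log\rho<\epsilon_\rho$ and $H_\zeta(\rho)<\epsilon_\rho\inf\rho$; and $$e^{\epsilon_\rho}\,\frac{(\deg(f)-q)\sigma^{-\zeta}+qL^{\zeta}[1+(L-1)^{\zeta}]}{\deg(f)}<1 .$$ Assume also (G1) there is $0<\alpha<1$ such that for $m_1$-a.e. $x\in M$, $d_2(G(x,z_1),G(x,z_2))\le\alpha\, d_2(z_1,z_2)$ for all $z_1,z_2\in K$. Let $\pi_x:\Sigma\to M$ be the projection. For a signed Borel measure $\mu=\mu^+-\mu^-$ (Jordan decomposition) on $\Sigma$ with $\pi_{x*}\mu^{\pm}\ll m_1$ put $\phi_x^\pm=d(\pi_{x*}\mu^\pm)/dm_1$, $\phi_x=\phi_x^+-\phi_x^-$, and let $\mu^\pm|_\gamma=\phi_x^\pm(\gamma)\,\mu^\pm_\gamma$, where $(\mu^\pm_\gamma)_{\gamma\in M}$ are the conditional probabilities on $K$ of the disintegration of $\mu^\pm$ along the fibres $\{\gamma\}\times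 K$. For finite measures on $K$ let $W_1^\zeta(\mu,\nu)=\sup\{|\int g\,d\mu-\int g\,d\nu| : H_\zeta(g)\le1,\ |g|_\infty\le1\}$. Let $S^\infty$ be the set of signed Borel measures $\mu$ on $\Sigma$ with $\pi_{x*}\mu^\pm\ll m_1$, with $\operatorname{ess\,sup}_{\gamma\in M} W_1^\zeta(\mu^+|_\gamma,\mu^-|_\gamma)<\infty$ (with respect to $m_1$), and such that $\phi_x$ coincides $m_1$-a.e. with a $\zeta$-Hölder function on $M$. Then there is exactly one $F$-invariant probability measure $\mu_0$ in $S^\infty$, and $\pi_{x*}\mu_0=m_1$. -/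

import Mathlib

open MeasureTheory Set
open scoped NNReal ENNReal Manifold ContDiff Topology Bundle

noncomputable section

namespace SkewProduct

section Base

variable {M : Type*}

/-- The degree `#f⁻¹(x)` of a map. For a local homeomorphism of a compact connected space the
cardinality of the fibre does not depend on the point, so one point is chosen. -/
def mapDegree [Nonempty M] (f : M → M) : ℕ :=
  (f ⁻¹' {Classical.arbitrary M}).ncard

/-- Around every `x` there is a neighbourhood `U` on which `f` is invertible onto its image, with
inverse branch Lipschitz of constant `L x`. The points of `f(U)` are written `f u`, `f v`. -/
def LocalInverseLipschitz [MetricSpace M] (f : M → M) (L : M → ℝ) : Prop :=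
  ∀ x, ∃ U ∈ 𝓝 x, InjOn f U ∧ ∀ u ∈ U, ∀ v ∈ U, dist u v ≤ L x * dist (f u) (f v)

/-- `J` is a Jacobian of `f` with respect to the measure `m`: `m (f A) = ∫_A J dm` for each
measurable set `A` on which `f` is injective. -/
structure IsJacobian [MeasurableSpace M] (f : M → M) (m : Measure M) (J : M → ℝ) : Prop where
  measurable : Measurable J
  nonneg : ∀ x, 0 ≤ J x
  image : ∀ A : Set M, MeasurableSet A → InjOn f A →
    m (f '' A) = ∫⁻ x in A, ENNReal.ofReal (J x) ∂m

/-- Condition on the expansion: `L(x) ≤ Λ` in the region `A` and `L(x) < σ⁻¹` outside. -/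
def CondF1 (L : M → ℝ) (A : Set M) (σ Λ : ℝ) : Prop :=
  (∀ x ∈ A, L x ≤ Λ) ∧ ∀ x ∈ Aᶜ, L x < σ⁻¹

/-- There is a finite covering of `M` by open domains of injectivity of `f`, such that `A` is
covered by `q < deg f` of these domains. -/
def CondF2 [TopologicalSpace M] [Nonempty M] (f : M → M) (A : Set M) (q : ℕ) : Prop :=
  q < mapDegree f ∧ ∃ 𝒰 : Finset (Set M),
    (∀ U ∈ 𝒰, IsOpen U ∧ InjOn f U) ∧ (⋃ U ∈ 𝒰, U) = univ ∧
    ∃ 𝒱 ⊆ 𝒰, 𝒱.card = q ∧ A ⊆ ⋃ U ∈ 𝒱, U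

/-- Small variation of the weight `ρ`: `sup log ρ - inf log ρ < ε` and `H_ζ(ρ) < ε inf ρ`. -/
def CondF3 [MetricSpace M] (ζ : ℝ≥0) (ρ : M → ℝ) (ε : ℝ) : Prop :=
  (⨆ x, Real.log (ρ x)) - (⨅ x, Real.log (ρ x)) < ε ∧
    eHolderNorm ζ ρ < ENNReal.ofReal (ε * ⨅ x, ρ x)

/-- The quantitative relation between the constants (`d` is the degree). -/
def CondConstants (ζ : ℝ≥0) (d q : ℕ) (σ Λ ε : ℝ) : Prop :=
  Real.exp ε *
    ((((d : ℝ) - q) * σ ^ (-(ζ : ℝ)) + q * Λ ^ (ζ : ℝ) * (1 + (Λ - 1) ^ (ζ : ℝ))) / d) < 1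

end Base

section Fibre

variable {M K : Type*}

/-- The skew product `F(x, z) = (f x, G(x, z))`. -/
def skew (f : M → M) (G : M × K → K) : M × K → M × K :=
  fun p => (f p.1, G p)

/-- `G` is uniformly contracting on `m`-almost every vertical fibre. -/
def CondG1 [MeasurableSpace M] [MetricSpace K] (m : Measure M) (G : M × K → K) : Prop :=
  ∃ α : ℝ, 0 < α ∧ α < 1 ∧
    ∀ᵐ x ∂m, ∀ z₁ z₂ : K, dist (G (x, z₁)) (G (x, z₂)) ≤ α * dist z₁ z₂

/-- The distance `sup |∫ g dμ - ∫ g dν|` over the functions `g` with `H_ζ(g) ≤ 1`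
and `|g|_∞ ≤ 1`. -/
def wDist [MetricSpace K] [MeasurableSpace K] (ζ : ℝ≥0) (μ ν : Measure K) : ℝ≥0∞ :=
  ⨆ (g : K → ℝ) (_ : HolderWith 1 ζ g) (_ : ∀ z, |g z| ≤ 1),
    ENNReal.ofReal |∫ z, g z ∂μ - ∫ z, g z ∂ν|

variable [MeasurableSpace M] [MeasurableSpace K]

/-- The restriction `μ|_x` of a positive measure to the fibre over `x`, as a measure on `K`:
the marginal density at `x` times the conditional probability given by the disintegration of `μ`
along the vertical fibres. -/
def fibreRestriction [StandardBorelSpace K] [Nonempty K] (m : Measure M)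
    (μ : Measure (M × K)) [IsFiniteMeasure μ] (x : M) : Measure K :=
  μ.fst.rnDeriv m x • μ.condKernel x

/-- The positive part of the Jordan decomposition. -/
abbrev posM (μ : SignedMeasure (M × K)) : Measure (M × K) :=
  μ.toJordanDecomposition.posPart

/-- The negative part of the Jordan decomposition. -/
abbrev negM (μ : SignedMeasure (M × K)) : Measure (M × K) :=
  μ.toJordanDecomposition.negPart

/-- Signed measures whose positive and negative parts have marginals absolutely continuous
with respect to `m`. -/
def AB (m : Measure M) : Set (SignedMeasure (M × K)) :=
  {μ | (posM μ).fst ≪ m ∧ (negM μ).fst ≪ m}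

/-- The marginal density `φ_x = φ_x⁺ - φ_x⁻`. -/
def marginalDensity (m : Measure M) (μ : SignedMeasure (M × K)) (x : M) : ℝ :=
  ((posM μ).fst.rnDeriv m x).toReal - ((negM μ).fst.rnDeriv m x).toReal

/-- The space `𝓛^∞`. -/
def LInfty [MetricSpace K] [StandardBorelSpace K] [Nonempty K] (m : Measure M) (ζ : ℝ≥0) :
    Set (SignedMeasure (M × K)) :=
  {μ | μ ∈ AB m ∧
    essSup (fun x => wDist ζ (fibreRestriction m (posM μ) x) (fibreRestriction m (negM μ) x)) m
      < ⊤}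

/-- The space `S^∞`: elements of `𝓛^∞` whose marginal density, a function defined `m`-almost
everywhere, is (has a representative that is) `ζ`-Hölder on `M`. -/
def SInfty [MetricSpace M] [MetricSpace K] [StandardBorelSpace K] [Nonempty K]
    (m : Measure M) (ζ : ℝ≥0) : Set (SignedMeasure (M × K)) :=
  {μ | μ ∈ LInfty m ζ ∧
    ∃ h : M → ℝ, (∃ C : ℝ≥0, HolderWith C ζ h) ∧ marginalDensity m μ =ᵐ[m] h}

end Fibre

end SkewProduct

end

/-!
The contraction on the fibres makes `ψ ∘ Fⁿ` nearly constant on each fibre for continuous `ψ`, so an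
invariant probability is determined by its marginal. Conversely, a weak limit of the iterates
`Fⁿ_*(m₁ × δ_z)` is invariant although `F` need not be continuous: measures with the same marginal
that converge weakly also converge on bounded measurable functions that are continuous on the
fibres, and `ψ ∘ F` is one of these.

It remains to see that an invariant probability in `S^∞` has marginal `m₁`. The density `φ` of this
marginal is continuous and, on the support of `m₁`, fixed by the transfer operator of weight `ρ`.
The points where `φ` attains its maximum over the support form a closed backward invariant set `Z`,
and the operator contracts the function `dist(·, Z)` by a factor `t < 1`, because it is
`1`-Lipschitz and vanishes on `Z`. So an estimate `max φ - φ ≤ η + k dist(·, Z)`, which holds for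
every `η > 0` with some `k`, self-improves to `max φ - φ ≤ η + k tⁿ dist(·, Z)`, and `φ` is
constant.
-/

noncomputable section

open Filter

namespace SkewProduct

/-! ### Invariant measures of the skew product over a fixed marginal -/

section FibreContraction

variable {M K : Type*}

theorem lipschitzWith_iterate_skew [PseudoEMetricSpace K] {f : M → M} {G : M × K → K} {α : ℝ≥0}
    (hG : ∀ x, LipschitzWith α fun z => G (x, z)) (n : ℕ) (x : M) :
    LipschitzWith (α ^ n) fun z => ((skew f G)^[n] (x, z)).2 := by
  induction n generalizing x with
  | zero => exact LipschitzWith.id.weaken (pow_zero α).ge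
  | succ n ih => exact pow_succ α n ▸ (ih (f x)).comp (hG x)

theorem fst_iterate_skew (f : M → M) (G : M × K → K) (n : ℕ) (p : M × K) :
    ((skew f G)^[n] p).1 = f^[n] p.1 :=
  Function.Semiconj.iterate_right (f := Prod.fst) (fun _ => rfl) n p

theorem eventually_dist_comp_iterate_skew_le [PseudoMetricSpace M] [CompactSpace M]
    [PseudoMetricSpace K] [CompactSpace K] {f : M → M} {G : M × K → K} {α : ℝ≥0} (hα : α < 1)
    (hG : ∀ x, LipschitzWith α fun z => G (x, z)) {ψ : M × K → ℝ} (hψ : Continuous ψ)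
    {ε : ℝ} (hε : 0 < ε) :
    ∀ᶠ n in atTop, ∀ x z₁ z₂,
      dist (ψ ((skew f G)^[n] (x, z₁))) (ψ ((skew f G)^[n] (x, z₂))) ≤ ε := by
  obtain ⟨δ, hδ, hψδ⟩ := Metric.uniformContinuous_iff.1
    (CompactSpace.uniformContinuous_of_continuous hψ) ε hε
  have hlim : Tendsto (fun n : ℕ => (α : ℝ) ^ n * Metric.diam (univ : Set K)) atTop (𝓝 0) := by
    simpa using (tendsto_pow_atTop_nhds_zero_of_lt_one α.2 hα).mul_const _
  filter_upwards [hlim.eventually (gt_mem_nhds hδ)] with n hn x z₁ z₂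
  refine (hψδ ?_).le
  rw [Prod.dist_eq, fst_iterate_skew, fst_iterate_skew, dist_self, max_lt_iff]
  refine ⟨hδ, lt_of_le_of_lt ?_ hn⟩
  calc dist ((skew f G)^[n] (x, z₁)).2 ((skew f G)^[n] (x, z₂)).2
      ≤ (α : ℝ) ^ n * dist z₁ z₂ := by
        simpa using (lipschitzWith_iterate_skew hG n x).dist_le_mul z₁ z₂
    _ ≤ (α : ℝ) ^ n * Metric.diam (univ : Set K) := by
        gcongr
        exact Metric.dist_le_diam_of_mem isCompact_univ.isBounded (mem_univ _) (mem_univ _)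

variable [MeasurableSpace M] [MeasurableSpace K]

theorem measurable_skew {f : M → M} {G : M × K → K} (hf : Measurable f) (hG : Measurable G) :
    Measurable (skew f G) :=
  (hf.comp measurable_fst).prodMk hG

theorem fst_map_iterate_skew {f : M → M} {m : Measure M} (hf : MeasurePreserving f m m)
    {G : M × K → K} (hG : Measurable G) {μ : Measure (M × K)} (hμ : μ.fst = m) (n : ℕ) :
    (μ.map (skew f G)^[n]).fst = m := by
  have hcomp : Prod.fst ∘ (skew f G)^[n] = f^[n] ∘ Prod.fst := funext (fst_iterate_skew f G n)
  rw [Measure.fst, Measure.map_map measurable_fst ((measurable_skew hf.measurable hG).iterate n),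
    hcomp, ← Measure.map_map (hf.iterate n).measurable measurable_fst, ← Measure.fst, hμ,
    (hf.iterate n).map_eq]

theorem map_fst_eq_of_measurePreserving_skew {f : M → M} {G : M × K → K} {ν : Measure (M × K)}
    (hf : Measurable f) (hν : MeasurePreserving (skew f G) ν ν) : ν.fst.map f = ν.fst := by
  have hcomp : f ∘ Prod.fst = Prod.fst ∘ skew f G := rfl
  rw [Measure.fst, Measure.map_map hf measurable_fst, hcomp,
    ← Measure.map_map measurable_fst hν.measurable, hν.map_eq]

theorem CondG1.exists_lipschitzWith [MetricSpace K] [Nonempty K] {m : Measure M} {G : M × K → K}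
    (hG : Measurable G) (h : CondG1 m G) :
    ∃ (G' : M × K → K) (α : ℝ≥0), Measurable G' ∧ α < 1 ∧
      (∀ x, LipschitzWith α fun z => G' (x, z)) ∧ ∀ᵐ x ∂m, ∀ z, G' (x, z) = G (x, z) := by
  classical
  obtain ⟨α, hα0, hα1, hae⟩ := h
  obtain ⟨z₀⟩ := ‹Nonempty K›
  obtain ⟨t, hsub, ht, hnull⟩ := exists_measurable_superset_of_null (ae_iff.1 hae)
  refine ⟨fun p => if p.1 ∈ t then z₀ else G p, ⟨α, hα0.le⟩,
    Measurable.ite (measurable_fst ht) measurable_const hG, hα1, fun x => ?_, ?_⟩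
  · by_cases hx : x ∈ t
    · simpa only [hx, if_true] using LipschitzWith.const' z₀
    · have hcontr : ∀ z₁ z₂ : K, dist (G (x, z₁)) (G (x, z₂)) ≤ α * dist z₁ z₂ := by
        by_contra hcon
        exact hx (hsub hcon)
      simpa only [hx, if_false] using LipschitzWith.of_dist_le_mul hcontr
  · filter_upwards [measure_eq_zero_iff_ae_notMem.1 hnull] with x hx z
    simp [hx]

theorem skew_ae_eq {f : M → M} {G G' : M × K → K} {m : Measure M} {μ : Measure (M × K)}
    (hμ : μ.fst = m) (h : ∀ᵐ x ∂m, ∀ z, G' (x, z) = G (x, z)) : skew f G' =ᵐ[μ] skew f G := by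
  rw [← hμ] at h
  filter_upwards [ae_of_ae_map measurable_fst.aemeasurable h] with p hp
  exact Prod.ext rfl (hp p.2)

end FibreContraction

section FibreMeasures

variable {M K : Type*}

theorem measurable_of_measurable_edist {X Y : Type*} [MeasurableSpace X] [PseudoEMetricSpace Y]
    [SecondCountableTopology Y] [MeasurableSpace Y] [BorelSpace Y] {g : X → Y}
    (h : ∀ y, Measurable fun x => edist (g x) y) : Measurable g := by
  refine measurable_of_isClosed fun s hs => ?_
  obtain ⟨t, hts, htc, hst⟩ :=
    (TopologicalSpace.IsSeparable.of_separableSpace s).exists_countable_dense_subset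
  have hpre : g ⁻¹' s = {x | Metric.infEDist (g x) t = 0} := by
    ext x
    rw [(hst.antisymm (hs.closure_subset_iff.2 hts)), mem_preimage,
      Metric.mem_closure_iff_infEDist_zero, mem_ofPred_eq]
  rw [hpre]
  exact (Measurable.biInf t htc fun y _ => h y) (measurableSet_singleton 0)

theorem stronglyMeasurable_of_measurable_eval {X Y : Type*} [MeasurableSpace X]
    [TopologicalSpace K] [CompactSpace K] [SecondCountableTopology K] [LocallyCompactSpace K]
    [PseudoMetricSpace Y] [SecondCountableTopology Y] [MeasurableSpace Y] [BorelSpace Y]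
    {Θ : X → C(K, Y)} (hΘ : ∀ z, Measurable fun x => Θ x z) : StronglyMeasurable Θ := by
  borelize C(K, Y)
  obtain ⟨t, htc, ht⟩ := TopologicalSpace.exists_countable_dense K
  refine (measurable_of_measurable_edist fun g => ?_).stronglyMeasurable
  have hsup : ∀ x, edist (Θ x) g = ⨆ z : t, edist (Θ x z) (g z) := fun x => by
    rw [ContinuousMap.edist_eq_iSup, ht.ciSup' ((Θ x).continuous.edist g.continuous)]
  have := htc.to_subtype
  simp only [hsup]
  exact Measurable.iSup fun z => (hΘ z).edist measurable_const

theorem fst_eq_of_tendsto [MetricSpace M] [MeasurableSpace M] [BorelSpace M] [MetricSpace K]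
    [SecondCountableTopology K] [MeasurableSpace K] [BorelSpace K] {ι : Type*} {l : Filter ι}
    [l.NeBot] {m : Measure M} {μs : ι → ProbabilityMeasure (M × K)} {μ : ProbabilityMeasure (M × K)}
    (hμ : Tendsto μs l (𝓝 μ)) (hfst : ∀ i, (μs i : Measure (M × K)).fst = m) :
    (μ : Measure (M × K)).fst = m := by
  obtain ⟨i₀⟩ := l.nonempty_of_neBot
  let m' : ProbabilityMeasure M := (μs i₀).map continuous_fst.measurable.aemeasurable
  have hconst : ∀ i, (μs i).map continuous_fst.measurable.aemeasurable = m' := fun i =>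
    Subtype.ext ((hfst i).trans (hfst i₀).symm)
  have hlim := ((ProbabilityMeasure.continuous_map continuous_fst).tendsto μ).comp hμ
  have hmap := tendsto_nhds_unique (hlim.congr hconst) tendsto_const_nhds
  exact (congrArg Subtype.val hmap).trans (hfst i₀)

variable [MetricSpace M] [CompactSpace M] [MeasurableSpace M] [BorelSpace M]
  [MetricSpace K] [CompactSpace K] [MeasurableSpace K] [BorelSpace K]

theorem integrable_continuous_comp {X Y : Type*} [MeasurableSpace X] {μ : Measure X}
    [IsFiniteMeasure μ] [TopologicalSpace Y] [CompactSpace Y] [MeasurableSpace Y]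
    [OpensMeasurableSpace Y] {ψ : Y → ℝ} (hψ : Continuous ψ) {T : X → Y} (hT : Measurable T) :
    Integrable (fun x => ψ (T x)) μ :=
  ((BoundedContinuousFunction.mkOfCompact ⟨ψ, hψ⟩).integrable (μ.map T)).comp_measurable hT

-- The measurable family `x ↦ θ (x, ·)` is approximated in `L¹(m; C(K))` by a continuous one.
theorem exists_continuous_integral_sub_le (m : Measure M) [IsFiniteMeasure m]
    {θ : M × K → ℝ} (hθ : Measurable θ) (hθc : ∀ x, Continuous fun z => θ (x, z))
    {C : ℝ} (hC : ∀ p, |θ p| ≤ C) {ε : ℝ} (hε : 0 < ε) :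
    ∃ ψ : M × K → ℝ, Continuous ψ ∧ ∀ μ : Measure (M × K), IsFiniteMeasure μ → μ.fst = m →
      dist (∫ p, θ p ∂μ) (∫ p, ψ p ∂μ) ≤ ε := by
  let Θ : M → C(K, ℝ) := fun x => ⟨fun z => θ (x, z), hθc x⟩
  have hΘ : StronglyMeasurable Θ := stronglyMeasurable_of_measurable_eval fun z =>
    hθ.comp (measurable_id.prodMk measurable_const)
  have hΘi : Integrable Θ m := Integrable.of_bound hΘ.aestronglyMeasurable |C| (ae_of_all _
    fun x => (ContinuousMap.norm_le _ (abs_nonneg C)).2 fun z => (hC (x, z)).trans (le_abs_self C))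
  obtain ⟨g, hg, hgi⟩ := hΘi.exists_boundedContinuous_integral_sub_le hε
  have hψ : Continuous fun p : M × K => g p.1 p.2 :=
    continuous_eval.comp ((g.continuous.comp continuous_fst).prodMk continuous_snd)
  refine ⟨fun p => g p.1 p.2, hψ, fun μ _ hμ => ?_⟩
  subst hμ
  have hθi : Integrable θ μ := Integrable.of_bound hθ.aestronglyMeasurable C (ae_of_all _ hC)
  have hψi : Integrable (fun p : M × K => g p.1 p.2) μ :=
    integrable_continuous_comp hψ measurable_id
  have hdiff : Integrable (fun x => ‖Θ x - g x‖) μ.fst := (hΘi.sub hgi).norm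
  rw [Real.dist_eq, ← integral_sub hθi hψi]
  calc |∫ p, (θ p - g p.1 p.2) ∂μ| ≤ ∫ p, |θ p - g p.1 p.2| ∂μ := abs_integral_le_integral_abs
    _ ≤ ∫ p, ‖Θ p.1 - g p.1‖ ∂μ :=
        integral_mono (hθi.sub hψi).abs (hdiff.comp_measurable measurable_fst) fun p =>
          (Θ p.1 - g p.1).norm_coe_le_norm p.2
    _ = ∫ x, ‖Θ x - g x‖ ∂μ.fst :=
        (integral_map measurable_fst.aemeasurable hdiff.aestronglyMeasurable).symm
    _ ≤ ε := hg

theorem tendsto_integral_of_fst_eq {ι : Type*} {l : Filter ι} [l.NeBot] {m : Measure M}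
    {μs : ι → ProbabilityMeasure (M × K)} {μ : ProbabilityMeasure (M × K)}
    (hμ : Tendsto μs l (𝓝 μ)) (hfst : ∀ i, (μs i : Measure (M × K)).fst = m)
    {θ : M × K → ℝ} (hθ : Measurable θ) (hθc : ∀ x, Continuous fun z => θ (x, z))
    {C : ℝ} (hC : ∀ p, |θ p| ≤ C) :
    Tendsto (fun i => ∫ p, θ p ∂(μs i : Measure (M × K))) l
      (𝓝 (∫ p, θ p ∂(μ : Measure (M × K)))) := by
  have hμfst := fst_eq_of_tendsto hμ hfst
  have : IsFiniteMeasure m := hμfst ▸ inferInstance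
  rw [Metric.tendsto_nhds]
  intro ε hε
  obtain ⟨ψ, hψ, happ⟩ :=
    exists_continuous_integral_sub_le m hθ hθc hC (ε := ε / 4) (by positivity)
  have hlim := ProbabilityMeasure.tendsto_iff_forall_integral_tendsto.1 hμ
    (BoundedContinuousFunction.mkOfCompact ⟨ψ, hψ⟩)
  filter_upwards [Metric.tendsto_nhds.1 hlim (ε / 4) (by positivity)] with i hi
  refine (dist_triangle4_right _ _ (∫ p, ψ p ∂(μs i : Measure (M × K)))
    (∫ p, ψ p ∂(μ : Measure (M × K)))).trans_lt ?_
  have hi' : dist (∫ p, ψ p ∂(μs i : Measure (M × K))) (∫ p, ψ p ∂(μ : Measure (M × K))) < ε / 4 :=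
    hi
  linarith [happ (μs i) inferInstance (hfst i), happ μ inferInstance hμfst]

end FibreMeasures

section InvariantMeasures

variable {M K : Type*}

theorem dist_integral_fst_le [MeasurableSpace M] [MeasurableSpace K] {μ : Measure (M × K)}
    [IsProbabilityMeasure μ] {ψ : M × K → ℝ} (hψ : Measurable ψ) (hψi : Integrable ψ μ) {ε : ℝ}
    (z₀ : K) (hε : ∀ x z, dist (ψ (x, z)) (ψ (x, z₀)) ≤ ε) :
    dist (∫ p, ψ p ∂μ) (∫ x, ψ (x, z₀) ∂μ.fst) ≤ ε := by
  have hsec : Measurable fun x => ψ (x, z₀) := hψ.comp (measurable_id.prodMk measurable_const)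
  have hdiff : Integrable (fun p : M × K => ψ p - ψ (p.1, z₀)) μ :=
    Integrable.of_bound (hψ.sub (hsec.comp measurable_fst)).aestronglyMeasurable ε
      (ae_of_all _ fun p => hε p.1 p.2)
  have hseci : Integrable (fun p : M × K => ψ (p.1, z₀)) μ :=
    (hψi.sub hdiff).congr (ae_of_all _ fun p => sub_sub_cancel _ _)
  rw [Measure.fst, integral_map measurable_fst.aemeasurable hsec.aestronglyMeasurable,
    Real.dist_eq, ← integral_sub hψi hseci]
  have hbound : ∀ p : M × K, ‖ψ p - ψ (p.1, z₀)‖ ≤ ε := fun p => hε p.1 p.2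
  simpa using norm_integral_le_of_norm_le_const (ae_of_all μ hbound)

variable [MetricSpace M] [CompactSpace M] [MeasurableSpace M] [BorelSpace M]
  [MetricSpace K] [CompactSpace K] [MeasurableSpace K] [BorelSpace K]
  {f : M → M} {m : Measure M} {G : M × K → K} {α : ℝ≥0}

theorem tendsto_integral_comp_iterate_skew_sub [Nonempty K] (hf : Measurable f)
    (hGm : Measurable G) (hα : α < 1) (hG : ∀ x, LipschitzWith α fun z => G (x, z))
    {μ ν : Measure (M × K)} [IsProbabilityMeasure μ] [IsProbabilityMeasure ν]
    (hμν : μ.fst = ν.fst) {ψ : M × K → ℝ} (hψ : Continuous ψ) :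
    Tendsto (fun n : ℕ => ∫ p, ψ ((skew f G)^[n] p) ∂μ - ∫ p, ψ ((skew f G)^[n] p) ∂ν) atTop
      (𝓝 0) := by
  obtain ⟨z₀⟩ := ‹Nonempty K›
  rw [Metric.tendsto_nhds]
  intro ε hε
  filter_upwards [eventually_dist_comp_iterate_skew_le (f := f) hα hG hψ (ε := ε / 3)
    (by positivity)] with n hn
  have hF : Measurable (skew f G)^[n] := (measurable_skew hf hGm).iterate n
  have hclose : ∀ (κ : Measure (M × K)) [IsProbabilityMeasure κ],
      dist (∫ p, ψ ((skew f G)^[n] p) ∂κ) (∫ x, ψ ((skew f G)^[n] (x, z₀)) ∂κ.fst) ≤ ε / 3 :=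
    fun κ _ => dist_integral_fst_le (hψ.measurable.comp hF) (integrable_continuous_comp hψ hF) z₀
      fun x z => hn x z z₀
  rw [dist_zero_right, ← dist_eq_norm]
  refine (dist_triangle_right _ _ (∫ x, ψ ((skew f G)^[n] (x, z₀)) ∂μ.fst)).trans_lt ?_
  have hν := hclose ν
  rw [← hμν] at hν
  linarith [hclose μ]

theorem eq_of_measurePreserving_skew [Nonempty K] (hf : Measurable f)
    (hGm : Measurable G) (hα : α < 1) (hG : ∀ x, LipschitzWith α fun z => G (x, z))
    {μ ν : Measure (M × K)} [IsProbabilityMeasure μ] [IsProbabilityMeasure ν]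
    (hμν : μ.fst = ν.fst) (hμ : MeasurePreserving (skew f G) μ μ)
    (hν : MeasurePreserving (skew f G) ν ν) : μ = ν := by
  refine ext_of_forall_integral_eq_of_IsFiniteMeasure fun ψ => ?_
  have hlim := tendsto_integral_comp_iterate_skew_sub hf hGm hα hG hμν ψ.continuous
  have hinv : ∀ {κ : Measure (M × K)}, MeasurePreserving (skew f G) κ κ →
      ∀ n, ∫ p, ψ ((skew f G)^[n] p) ∂κ = ∫ p, ψ p ∂κ := fun hκ n => by
    rw [← integral_map (hκ.iterate n).aemeasurable
      ψ.continuous.measurable.aestronglyMeasurable, (hκ.iterate n).map_eq]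
  simp only [hinv hμ, hinv hν] at hlim
  exact sub_eq_zero.1 (tendsto_nhds_unique tendsto_const_nhds hlim)

theorem measurePreserving_skew_of_tendsto [Nonempty K] (hf : MeasurePreserving f m m)
    (hGm : Measurable G) (hα : α < 1) (hG : ∀ x, LipschitzWith α fun z => G (x, z))
    {μ₀ : Measure (M × K)} [IsProbabilityMeasure μ₀] (hμ₀ : μ₀.fst = m)
    {l : Filter ℕ} [l.NeBot] (hl : l ≤ atTop) {μs : ℕ → ProbabilityMeasure (M × K)}
    (hμs : ∀ n, (μs n : Measure (M × K)) = μ₀.map (skew f G)^[n])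
    {μ : ProbabilityMeasure (M × K)} (hμ : Tendsto μs l (𝓝 μ)) :
    MeasurePreserving (skew f G) (μ : Measure (M × K)) μ := by
  have hF : Measurable (skew f G) := measurable_skew hf.measurable hGm
  have hfst : ∀ n, (μs n : Measure (M × K)).fst = m := fun n => by
    rw [hμs, fst_map_iterate_skew hf hGm hμ₀]
  refine ⟨hF, ?_⟩
  have : IsProbabilityMeasure ((μ : Measure (M × K)).map (skew f G)) :=
    Measure.isProbabilityMeasure_map hF.aemeasurable
  have : IsProbabilityMeasure (μ₀.map (skew f G)) :=
    Measure.isProbabilityMeasure_map hF.aemeasurable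
  refine ext_of_forall_integral_eq_of_IsFiniteMeasure fun ψ => ?_
  have hψ := ψ.continuous
  have hpush : Tendsto (fun n => ∫ p, ψ ((skew f G)^[n + 1] p) ∂μ₀) l
      (𝓝 (∫ p, ψ (skew f G p) ∂(μ : Measure (M × K)))) := by
    have hψG : ∀ x, Continuous fun z => ψ (skew f G (x, z)) := fun x =>
      hψ.comp ((continuous_const (y := f x)).prodMk (hG x).continuous)
    refine (tendsto_integral_of_fst_eq hμ hfst (hψ.measurable.comp hF) hψG
      fun p => ψ.norm_coe_le_norm _).congr fun n => ?_
    rw [hμs, integral_map (hF.iterate n).aemeasurable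
      (hψ.measurable.comp hF).aestronglyMeasurable]
    simp only [Function.comp_apply, Function.iterate_succ_apply']
  have hiter : Tendsto (fun n => ∫ p, ψ ((skew f G)^[n] p) ∂μ₀) l
      (𝓝 (∫ p, ψ p ∂(μ : Measure (M × K)))) := by
    refine (ProbabilityMeasure.tendsto_iff_forall_integral_tendsto.1 hμ ψ).congr fun n => ?_
    rw [hμs, integral_map (hF.iterate n).aemeasurable hψ.measurable.aestronglyMeasurable]
  have hdiff : Tendsto (fun n => ∫ p, ψ ((skew f G)^[n + 1] p) ∂μ₀ -
      ∫ p, ψ ((skew f G)^[n] p) ∂μ₀) l (𝓝 0) := by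
    refine ((tendsto_integral_comp_iterate_skew_sub hf.measurable hGm hα hG
      (μ := μ₀.map (skew f G)) ((fst_map_iterate_skew hf hGm hμ₀ 1).trans hμ₀.symm)
      hψ).mono_left hl).congr fun n => ?_
    exact congrArg (· - _) (integral_map hF.aemeasurable
      (hψ.measurable.comp (hF.iterate n)).aestronglyMeasurable)
  rw [integral_map hF.aemeasurable hψ.measurable.aestronglyMeasurable]
  exact sub_eq_zero.1 (tendsto_nhds_unique (hpush.sub hiter) hdiff)

theorem exists_measurePreserving_skew [Nonempty K] [IsProbabilityMeasure m]
    (hf : MeasurePreserving f m m) (hGm : Measurable G) (hα : α < 1)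
    (hG : ∀ x, LipschitzWith α fun z => G (x, z)) :
    ∃ μ : ProbabilityMeasure (M × K), MeasurePreserving (skew f G) (μ : Measure (M × K)) μ ∧
      (μ : Measure (M × K)).fst = m := by
  obtain ⟨z₀⟩ := ‹Nonempty K›
  let μ₀ : Measure (M × K) := m.prod (Measure.dirac z₀)
  have hμ₀ : μ₀.fst = m := by simp [μ₀]
  let μs : ℕ → ProbabilityMeasure (M × K) := fun n => ⟨μ₀.map (skew f G)^[n],
    Measure.isProbabilityMeasure_map ((measurable_skew hf.measurable hGm).iterate n).aemeasurable⟩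
  obtain ⟨μ, φ, hφ, hμ⟩ := CompactSpace.tendsto_subseq μs
  have hμ' : Tendsto μs (map φ atTop) (𝓝 μ) := tendsto_map'_iff.2 hμ
  exact ⟨μ, measurePreserving_skew_of_tendsto hf hGm hα hG hμ₀ hφ.tendsto_atTop (fun _ => rfl) hμ',
    fst_eq_of_tendsto hμ' fun n => fst_map_iterate_skew hf hGm hμ₀ n⟩

theorem existsUnique_measurePreserving_skew [Nonempty K] [IsProbabilityMeasure m]
    (hf : MeasurePreserving f m m) (hGm : Measurable G) (hG : CondG1 m G) :
    ∃! μ : ProbabilityMeasure (M × K), MeasurePreserving (skew f G) (μ : Measure (M × K)) μ ∧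
      (μ : Measure (M × K)).fst = m := by
  obtain ⟨G', α, hG'm, hα, hG', hae⟩ := hG.exists_lipschitzWith hGm
  have hiff : ∀ {μ : ProbabilityMeasure (M × K)}, (μ : Measure (M × K)).fst = m →
      (MeasurePreserving (skew f G') (μ : Measure (M × K)) μ ↔
        MeasurePreserving (skew f G) (μ : Measure (M × K)) μ) := fun hμ => by
    have hskew := skew_ae_eq (f := f) hμ hae
    exact ⟨fun h => h.congr (measurable_skew hf.measurable hGm) hskew,
      fun h => h.congr (measurable_skew hf.measurable hG'm) hskew.symm⟩
  obtain ⟨μ, hμ, hμfst⟩ := exists_measurePreserving_skew hf hG'm hα hG'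
  refine ⟨μ, ⟨(hiff hμfst).1 hμ, hμfst⟩, fun ν ⟨hν, hνfst⟩ => Subtype.ext ?_⟩
  exact eq_of_measurePreserving_skew (μ := (ν : Measure (M × K))) (ν := (μ : Measure (M × K)))
    hf.measurable hG'm hα hG' (hνfst.trans hμfst.symm) ((hiff hνfst).2 hν) hμ

end InvariantMeasures

/-! ### Length spaces -/

section LengthSpace

/-- A length space: the distance of two points is the infimum of the lengths of the paths joining
them, the length of a path being its total variation. -/
def IsLengthSpace (X : Type*) [PseudoEMetricSpace X] : Prop :=
  ∀ (x y : X) (r : ℝ≥0∞), edist x y < r → ∃ γ : Path x y, eVariationOn γ univ < r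

theorem IsLengthSpace.pathConnectedSpace {X : Type*} [PseudoMetricSpace X] [Nonempty X]
    (hX : IsLengthSpace X) : PathConnectedSpace X where
  nonempty := ‹_›
  joined x y := by
    obtain ⟨γ, -⟩ := hX x y ⊤ (edist_lt_top x y)
    exact ⟨γ⟩

theorem eVariationOn_comp_le_of_locally {X Y : Type*} [PseudoEMetricSpace X]
    [PseudoEMetricSpace Y] {C : ℝ≥0} {h : X → Y} (hh : ∀ x, ∃ V ∈ 𝓝 x, LipschitzOnWith C h V)
    {γ : unitInterval → X} (hγ : Continuous γ) :
    eVariationOn (h ∘ γ) univ ≤ C * eVariationOn γ univ := by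
  choose V hV hhV using hh
  obtain ⟨t, ht0, htm, ⟨n, hn⟩, htV⟩ := exists_monotone_Icc_subset_open_cover_unitInterval
    (c := fun x => γ ⁻¹' interior (V x)) (fun x => isOpen_interior.preimage hγ)
    (fun s _ => mem_iUnion.2 ⟨γ s, mem_interior_iff_mem_nhds.2 (hV _)⟩)
  have hIcc : Icc (t 0) (t n) = univ := by
    rw [ht0, hn n le_rfl]
    exact Icc_bot_top
  rw [← hIcc, ← eVariationOn.sum' _ htm, ← eVariationOn.sum' _ htm, Finset.mul_sum]
  refine Finset.sum_le_sum fun i _ => ?_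
  obtain ⟨x, hx⟩ := htV i
  exact (hhV x).comp_eVariationOn_le fun s hs => interior_subset (hx hs)

theorem IsLengthSpace.lipschitzWith_of_locally {X Y : Type*} [PseudoMetricSpace X]
    [PseudoEMetricSpace Y] (hX : IsLengthSpace X) {C : ℝ≥0} {h : X → Y}
    (hh : ∀ x, ∃ V ∈ 𝓝 x, LipschitzOnWith C h V) : LipschitzWith C h := by
  intro x y
  refine ENNReal.le_mul_of_forall_lt (.inr (edist_ne_top x y)) (.inl ENNReal.coe_ne_top)
    fun C' hC' r hr => ?_
  obtain ⟨γ, hγ⟩ := hX x y r hr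
  calc edist (h x) (h y) = edist ((h ∘ γ) 0) ((h ∘ γ) 1) := by simp
      _ ≤ eVariationOn (h ∘ γ) univ := eVariationOn.edist_le _ (mem_univ _) (mem_univ _)
      _ ≤ C * eVariationOn γ univ := eVariationOn_comp_le_of_locally hh γ.continuous
      _ ≤ C' * r := mul_le_mul' hC'.le hγ.le

theorem eVariationOn_le_pathELength (E : Type*) {M : Type*} [NormedAddCommGroup E]
    [NormedSpace ℝ E] [MetricSpace M] [ChartedSpace E M]
    [Bundle.RiemannianBundle (fun x : M => TangentSpace 𝓘(ℝ, E) x)]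
    [IsRiemannianManifold 𝓘(ℝ, E) M] {γ : ℝ → M}
    (hγ : ContMDiffOn 𝓘(ℝ) 𝓘(ℝ, E) 1 γ (Icc 0 1)) :
    eVariationOn (fun t : unitInterval => γ t) univ ≤
      Manifold.pathELength 𝓘(ℝ, E) γ 0 1 := by
  refine iSup_le fun ⟨n, t, ht, _⟩ => ?_
  have hstep : ∀ i, edist (γ (t (i + 1))) (γ (t i)) ≤
      Manifold.pathELength 𝓘(ℝ, E) γ (t i) (t (i + 1)) := fun i => by
    rw [edist_comm, IsRiemannianManifold.out (I := 𝓘(ℝ, E))]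
    exact Manifold.riemannianEDist_le_pathELength
      (hγ.mono (Icc_subset_Icc (t i).2.1 (t (i + 1)).2.2)) rfl rfl (ht i.le_succ)
  have hsum : ∀ k, ∑ i ∈ Finset.range k, edist (γ (t (i + 1))) (γ (t i)) ≤
      Manifold.pathELength 𝓘(ℝ, E) γ 0 (t k) := fun k => by
    induction k with
    | zero => simp
    | succ k ih =>
      rw [Finset.sum_range_succ, ← Manifold.pathELength_add (t k).2.1 (ht k.le_succ)]
      exact add_le_add ih (hstep k)
  exact (hsum n).trans (Manifold.pathELength_mono le_rfl (t n).2.2)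

theorem isLengthSpace_of_isRiemannianManifold (E M : Type*) [NormedAddCommGroup E]
    [NormedSpace ℝ E] [MetricSpace M] [ChartedSpace E M] [IsManifold 𝓘(ℝ, E) 1 M]
    [Bundle.RiemannianBundle (fun x : M => TangentSpace 𝓘(ℝ, E) x)]
    [IsRiemannianManifold 𝓘(ℝ, E) M] : IsLengthSpace M := by
  intro x y r hr
  rw [IsRiemannianManifold.out (I := 𝓘(ℝ, E)) x y] at hr
  obtain ⟨γ, hγ0, hγ1, hγ, hlen⟩ := Manifold.exists_lt_of_riemannianEDist_lt hr
  exact ⟨⟨⟨fun t => γ t, continuousOn_iff_continuous_domRestrict.1 hγ.continuousOn⟩, hγ0, hγ1⟩,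
    (eVariationOn_le_pathELength E hγ).trans_lt hlen⟩

end LengthSpace

/-! ### Fibre sums of a local homeomorphism -/

section FibreSum

variable {X Y : Type*} {f : X → Y}

/-- The sum of a real function over the fibre of `f` above a point; it is `0` above a point with
infinitely many non-zero terms. -/
def fibreSum (f : X → Y) (g : X → ℝ) (y : Y) : ℝ := ∑ᶠ x ∈ f ⁻¹' {y}, g x

theorem fibreSum_eq_sum {y : Y} (hy : (f ⁻¹' {y}).Finite) (g : X → ℝ) :
    fibreSum f g y = ∑ x ∈ hy.toFinset, g x :=
  finsum_mem_eq_finite_toFinset_sum _ _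

theorem fibreSum_mono {y : Y} (hy : (f ⁻¹' {y}).Finite) {g h : X → ℝ}
    (hgh : ∀ x, f x = y → g x ≤ h x) : fibreSum f g y ≤ fibreSum f h y := by
  rw [fibreSum_eq_sum hy, fibreSum_eq_sum hy]
  exact Finset.sum_le_sum fun x hx => hgh x (hy.mem_toFinset.1 hx)

theorem fibreSum_const_mul {y : Y} (hy : (f ⁻¹' {y}).Finite) (c : ℝ) (g : X → ℝ) :
    fibreSum f (fun x => c * g x) y = c * fibreSum f g y := by
  rw [fibreSum_eq_sum hy, fibreSum_eq_sum hy, Finset.mul_sum]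

theorem fibreSum_add {y : Y} (hy : (f ⁻¹' {y}).Finite) (g h : X → ℝ) :
    fibreSum f (fun x => g x + h x) y = fibreSum f g y + fibreSum f h y := by
  rw [fibreSum_eq_sum hy, fibreSum_eq_sum hy, fibreSum_eq_sum hy, Finset.sum_add_distrib]

theorem fibreSum_eq_sum_of_bijOn {ι : Type*} [Fintype ι] {y : Y} {s : ι → X}
    (hs : BijOn s univ (f ⁻¹' {y})) (g : X → ℝ) : fibreSum f g y = ∑ i, g (s i) := by
  rw [fibreSum, ← finsum_mem_eq_of_bijOn s hs fun _ _ => rfl, finsum_mem_univ,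
    finsum_eq_sum_of_fintype]

variable [TopologicalSpace X] [TopologicalSpace Y]

theorem CondF2.ncard_fibre_inter_le [Nonempty X] {f : X → X} {A : Set X} {q : ℕ}
    (h : CondF2 f A q) (y : X) : (f ⁻¹' {y} ∩ A).ncard ≤ q := by
  obtain ⟨-, 𝒰, hU, -, 𝒱, h𝒱, rfl, hA⟩ := h
  have hcover : ∀ x ∈ f ⁻¹' {y} ∩ A, ∃ U ∈ 𝒱, x ∈ U := fun x hx => by
    simpa using hA hx.2
  choose! U hU𝒱 hxU using hcover
  rw [← Set.ncard_coe_finset]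
  refine Set.ncard_le_ncard_of_injOn U hU𝒱 (fun x hx x' hx' hxx' => ?_) 𝒱.finite_toSet
  exact (hU _ (h𝒱 (hU𝒱 x hx))).2 (hxU x hx) (hxx' ▸ hxU x' hx') (hx.1.trans hx'.1.symm)

theorem finite_fibre [CompactSpace X] [T1Space Y] (hf : IsLocalHomeomorph f) (y : Y) :
    (f ⁻¹' {y}).Finite := by
  have hdiscrete : IsDiscrete (f '' (f ⁻¹' {y})) :=
    (subsingleton_singleton.anti (image_preimage_subset f {y})).isDiscrete
  exact (isClosed_singleton.preimage hf.continuous).isCompact.finite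
    (hf.isLocalHomeomorphOn.isDiscrete_of_image hdiscrete)

theorem exists_branches (hf : IsCoveringMap f) (y₀ : Y) :
    ∃ s : f ⁻¹' {y₀} → Y → X, (∀ i, ContinuousAt (s i) y₀) ∧
      ∀ᶠ y in 𝓝 y₀, BijOn (fun i => s i y) univ (f ⁻¹' {y}) := by
  classical
  obtain ⟨-, U, hyU, hU, -, H, hH⟩ := hf y₀
  have hHsymm : ∀ p, f (H.symm p) = p.1 := fun p => by rw [← hH, H.apply_symm_apply]
  refine ⟨fun i y => if hy : y ∈ U then H.symm (⟨y, hy⟩, i) else i, fun i => ?_, ?_⟩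
  · refine ContinuousOn.continuousAt (s := U) ?_ (hU.mem_nhds hyU)
    rw [continuousOn_iff_continuous_domRestrict]
    have hcont : Continuous fun y : U => (H.symm (y, i) : X) := by fun_prop
    exact hcont.congr fun y => by simp only [domRestrict_apply, y.2, dite_true]
  · filter_upwards [hU.mem_nhds hyU] with y hy
    simp only [hy, dite_true]
    refine ⟨fun i _ => hHsymm _, fun i _ j _ hij => ?_, fun x hx => ?_⟩
    · exact congrArg Prod.snd (H.symm.injective (Subtype.ext hij))
    · obtain rfl : f x = y := hx
      refine ⟨(H ⟨x, hy⟩).2, mem_univ _, ?_⟩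
      have hx' : (⟨f x, hy⟩, (H ⟨x, hy⟩).2) = H ⟨x, hy⟩ :=
        Prod.ext (Subtype.ext (hH ⟨x, hy⟩).symm) rfl
      simp only [hx', H.symm_apply_apply]

variable [CompactSpace X] [T2Space X] [T2Space Y]

theorem continuous_fibreSum (hf : IsLocalHomeomorph f) {g : X → ℝ} (hg : Continuous g) :
    Continuous (fibreSum f g) := by
  refine continuous_iff_continuousAt.2 fun y₀ => ?_
  have := (finite_fibre hf y₀).fintype
  obtain ⟨s, hs, hbij⟩ := exists_branches (isLocalHomeomorph_iff_isCoveringMap.1 hf) y₀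
  refine ContinuousAt.congr (f := fun y => ∑ i, g (s i y)) ?_
    (hbij.mono fun y hy => (fibreSum_eq_sum_of_bijOn hy g).symm)
  exact tendsto_finsetSum _ fun i _ => hg.continuousAt.comp (hs i)

theorem ncard_fibre_eq [PreconnectedSpace Y] (hf : IsLocalHomeomorph f) (y y' : Y) :
    (f ⁻¹' {y}).ncard = (f ⁻¹' {y'}).ncard := by
  refine IsLocallyConstant.apply_eq_of_preconnectedSpace (f := fun y => (f ⁻¹' {y}).ncard)
    ((IsLocallyConstant.iff_eventually_eq _).2 fun y₀ => ?_) y y'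
  obtain ⟨s, -, hbij⟩ := exists_branches (isLocalHomeomorph_iff_isCoveringMap.1 hf) y₀
  have hncard : ∀ᶠ y in 𝓝 y₀, (f ⁻¹' {y}).ncard = Nat.card (f ⁻¹' {y₀}) :=
    hbij.mono fun y hy => by
      rw [← hy.image_eq, hy.injOn.ncard_image, ncard_univ]
  filter_upwards [hncard] with y hy
  rw [hy, hncard.self_of_nhds]

end FibreSum

/-! ### Rigidity of the fixed points of the transfer operator -/

section InverseBranches

variable {M : Type*} [MetricSpace M] [CompactSpace M] {f : M → M} {L : M → ℝ}

theorem LocalInverseLipschitz.exists_lipschitzOnWith_fibreSum (hL : LocalInverseLipschitz f L)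
    (hf : IsLocalHomeomorph f) {c : ℝ≥0} (hc : ∀ y, fibreSum f L y ≤ c) {u : M → ℝ}
    (hu : LipschitzWith 1 u) (y₀ : M) :
    ∃ V ∈ 𝓝 y₀, LipschitzOnWith c (fibreSum f u) V := by
  have := (finite_fibre hf y₀).fintype
  obtain ⟨s, hs, hbij⟩ := exists_branches (isLocalHomeomorph_iff_isCoveringMap.1 hf) y₀
  choose U hU _ hLU using hL
  refine ⟨_, hbij.and (eventually_all.2 fun i => hs i (hU (s i y₀))), ?_⟩
  refine LipschitzOnWith.of_dist_le_mul fun a ⟨hsa, hUa⟩ b ⟨hsb, hUb⟩ => ?_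
  have hbranch : ∀ i, dist (u (s i a)) (u (s i b)) ≤ L (s i y₀) * dist a b := fun i => by
    have hfa : f (s i a) = a := hsa.mapsTo (mem_univ i)
    have hfb : f (s i b) = b := hsb.mapsTo (mem_univ i)
    calc dist (u (s i a)) (u (s i b)) ≤ dist (s i a) (s i b) := by
          simpa only [NNReal.coe_one, one_mul] using hu.dist_le_mul (s i a) (s i b)
      _ ≤ L (s i y₀) * dist (f (s i a)) (f (s i b)) := hLU _ _ (hUa i) _ (hUb i)
      _ = L (s i y₀) * dist a b := by rw [hfa, hfb]
  calc dist (fibreSum f u a) (fibreSum f u b)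
      = dist (∑ i, u (s i a)) (∑ i, u (s i b)) := by
        rw [fibreSum_eq_sum_of_bijOn hsa, fibreSum_eq_sum_of_bijOn hsb]
    _ ≤ ∑ i, dist (u (s i a)) (u (s i b)) := dist_sum_sum_le _ _ _
    _ ≤ ∑ i, L (s i y₀) * dist a b := Finset.sum_le_sum fun i _ => hbranch i
    _ = fibreSum f L y₀ * dist a b := by
        rw [fibreSum_eq_sum_of_bijOn hbij.self_of_nhds, Finset.sum_mul]
    _ ≤ c * dist a b := by gcongr; exact hc y₀

theorem lipschitzWith_fibreSum (hM : IsLengthSpace M) (hf : IsLocalHomeomorph f)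
    (hL : LocalInverseLipschitz f L) {c : ℝ≥0} (hc : ∀ y, fibreSum f L y ≤ c) {u : M → ℝ}
    (hu : LipschitzWith 1 u) : LipschitzWith c (fibreSum f u) :=
  hM.lipschitzWith_of_locally (hL.exists_lipschitzOnWith_fibreSum hf hc hu)

theorem fibreSum_le_of_condF1_of_condF2 [Nonempty M] [PreconnectedSpace M]
    (hf : IsLocalHomeomorph f) {A : Set M} {σ Λ : ℝ} {q : ℕ} (hσΛ : σ⁻¹ ≤ Λ)
    (hf1 : CondF1 L A σ Λ) (hf2 : CondF2 f A q) (y : M) :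
    fibreSum f L y ≤ ((mapDegree f : ℝ) - q) * σ⁻¹ + q * Λ := by
  classical
  set s := (finite_fibre hf y).toFinset with hs
  have hcard : s.card = mapDegree f := by
    rw [hs, ← ncard_eq_toFinset_card _ (finite_fibre hf y), mapDegree, ncard_fibre_eq hf]
  have hcardA : (s.filter (· ∈ A)).card ≤ q := by
    have hcoe : (s.filter (· ∈ A) : Set M) = f ⁻¹' {y} ∩ A := by ext; simp [hs]
    rw [← Set.ncard_coe_finset, hcoe]
    exact hf2.ncard_fibre_inter_le y
  calc fibreSum f L y = ∑ x ∈ s, L x := fibreSum_eq_sum _ _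
    _ ≤ ∑ x ∈ s, (σ⁻¹ + if x ∈ A then Λ - σ⁻¹ else 0) := by
        refine Finset.sum_le_sum fun x _ => ?_
        split_ifs with hx
        · linarith [hf1.1 x hx]
        · linarith [hf1.2 x hx]
    _ = mapDegree f * σ⁻¹ + (s.filter (· ∈ A)).card * (Λ - σ⁻¹) := by
        rw [Finset.sum_add_distrib, ← Finset.sum_filter]
        simp only [Finset.sum_const, nsmul_eq_mul, hcard]
    _ ≤ mapDegree f * σ⁻¹ + q * (Λ - σ⁻¹) := by
        have := sub_nonneg.2 hσΛ
        gcongr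
    _ = ((mapDegree f : ℝ) - q) * σ⁻¹ + q * Λ := by ring

theorem CondConstants.linear {ζ : ℝ≥0} {d q : ℕ} {σ Λ ε : ℝ} (hζ : ζ ≤ 1) (hqd : q ≤ d)
    (hσ : 1 ≤ σ) (hΛ1 : 1 ≤ Λ) (hΛ2 : Λ ≤ 2) (h : CondConstants ζ d q σ Λ ε) :
    Real.exp ε / d * (((d : ℝ) - q) * σ⁻¹ + q * Λ) < 1 := by
  refine lt_of_le_of_lt ?_ h
  have hζ' : (ζ : ℝ) ≤ 1 := by exact_mod_cast hζ
  have hqd' : (0 : ℝ) ≤ (d : ℝ) - q := sub_nonneg.2 (by exact_mod_cast hqd)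
  have hσζ : σ⁻¹ ≤ σ ^ (-(ζ : ℝ)) := by
    rw [← Real.rpow_neg_one]
    exact Real.rpow_le_rpow_of_exponent_le hσ (by linarith)
  have hΛζ : Λ ≤ Λ ^ (ζ : ℝ) * (1 + (Λ - 1) ^ (ζ : ℝ)) := by
    have h1 : Λ - 1 ≤ (Λ - 1) ^ (ζ : ℝ) :=
      Real.self_le_rpow_of_le_one (by linarith) (by linarith) hζ'
    have h2 : 1 ≤ Λ ^ (ζ : ℝ) := Real.one_le_rpow hΛ1 ζ.coe_nonneg
    nlinarith
  rw [div_mul_eq_mul_div, mul_div_assoc, mul_assoc (q : ℝ)]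
  gcongr

end InverseBranches

section TransferOperator

variable {M : Type*} {f : M → M} {ρ : M → ℝ}

/-- The transfer operator `φ ↦ ∑_{f x = y} ρ(x) φ(x)` of `f` with weight `ρ`. -/
def transfer (f : M → M) (ρ φ : M → ℝ) (y : M) : ℝ := fibreSum f (fun x => ρ x * φ x) y

theorem transfer_const_add_mul {y : M} (hy : (f ⁻¹' {y}).Finite) (a b : ℝ) (φ : M → ℝ) :
    transfer f ρ (fun x => a + b * φ x) y = a * fibreSum f ρ y + b * transfer f ρ φ y := by
  have hdistrib : (fun x => ρ x * (a + b * φ x)) = fun x => a * ρ x + b * (ρ x * φ x) := by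
    ext x; ring
  rw [transfer, transfer, hdistrib, fibreSum_add hy, fibreSum_const_mul hy, fibreSum_const_mul hy]

variable {S : Set M}

theorem preimage_zeros_subset_of_transfer_eq (hfin : ∀ y, (f ⁻¹' {y}).Finite)
    (hρ : ∀ x, 0 < ρ x) (hSf : f ⁻¹' S ⊆ S) {w : M → ℝ} (hw : ∀ x ∈ S, 0 ≤ w x)
    (hfix : ∀ y ∈ S, transfer f ρ w y = w y) :
    f ⁻¹' {x ∈ S | w x = 0} ⊆ {x ∈ S | w x = 0} := by
  rintro x ⟨hxS, hx0⟩
  have hsum := hfix (f x) hxS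
  rw [hx0, transfer, fibreSum_eq_sum (hfin (f x)), Finset.sum_eq_zero_iff_of_nonneg] at hsum
  · exact ⟨hSf hxS, (mul_eq_zero.1 (hsum x (by simp))).resolve_left (hρ x).ne'⟩
  · intro x' hx'
    have hx'' : f x' = f x := by simpa using hx'
    exact mul_nonneg (hρ x').le (hw x' (hSf (show f x' ∈ S from hx'' ▸ hxS)))

theorem le_of_transfer_eq_of_le_add_mul (hfin : ∀ y, (f ⁻¹' {y}).Finite) (hρ : ∀ x, 0 ≤ ρ x)
    (hSf : f ⁻¹' S ⊆ S) (hρ1 : ∀ y ∈ S, fibreSum f ρ y = 1) {w u : M → ℝ}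
    (hfix : ∀ y ∈ S, transfer f ρ w y = w y) {t : ℝ} (ht0 : 0 ≤ t) (ht1 : t < 1)
    (hu : ∀ y ∈ S, transfer f ρ u y ≤ t * u y) {η k : ℝ} (hk : 0 ≤ k)
    (hwu : ∀ y ∈ S, w y ≤ η + k * u y) {y : M} (hy : y ∈ S) : w y ≤ η := by
  have hiter : ∀ n : ℕ, ∀ y ∈ S, w y ≤ η + k * t ^ n * u y := fun n => by
    induction n with
    | zero => simpa only [pow_zero, mul_one] using hwu
    | succ n ih =>
      intro y hy
      have hmono : transfer f ρ w y ≤ transfer f ρ (fun x => η + k * t ^ n * u x) y :=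
        fibreSum_mono (hfin y) fun x hx =>
          mul_le_mul_of_nonneg_left (ih x (hSf (show f x ∈ S from hx ▸ hy))) (hρ x)
      calc w y ≤ η + k * t ^ n * transfer f ρ u y := by
            rwa [hfix y hy, transfer_const_add_mul (hfin y), hρ1 y hy, mul_one] at hmono
        _ ≤ η + k * t ^ n * (t * u y) := by gcongr; exact hu y hy
        _ = η + k * t ^ (n + 1) * u y := by ring
  have hlim : Tendsto (fun n : ℕ => η + k * t ^ n * u y) atTop (𝓝 η) := by
    have := ((tendsto_pow_atTop_nhds_zero_of_lt_one ht0 ht1).const_mul k).mul_const (u y)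
    simpa using this.const_add η
  exact ge_of_tendsto' hlim fun n => hiter n y hy

variable [MetricSpace M] [CompactSpace M]

theorem exists_le_add_mul_infDist {Z : Set M} (hZ : IsClosed Z) (hZne : Z.Nonempty) {w : M → ℝ}
    (hw : Continuous w) (hwZ : ∀ z ∈ Z, w z ≤ 0) {η : ℝ} (hη : 0 < η) :
    ∃ k, 0 ≤ k ∧ ∀ x, w x ≤ η + k * Metric.infDist x Z := by
  have hpos : ∀ x ∈ {x | η ≤ w x}, 0 < Metric.infDist x Z := fun x hx =>
    (hZ.notMem_iff_infDist_pos hZne).1 fun hxZ => (hη.trans_le hx).not_ge (hwZ x hxZ)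
  obtain ⟨B, hB⟩ := (isClosed_le continuous_const hw).isCompact.bddAbove_image
    (hw.continuousOn.div (Metric.continuous_infDist_pt Z).continuousOn fun x hx => (hpos x hx).ne')
  refine ⟨max B 0, le_max_right _ _, fun x => ?_⟩
  rcases lt_or_ge (w x) η with hx | hx
  · have : 0 ≤ max B 0 * Metric.infDist x Z :=
      mul_nonneg (le_max_right _ _) Metric.infDist_nonneg
    linarith
  · have : w x ≤ max B 0 * Metric.infDist x Z :=
      (div_le_iff₀ (hpos x hx)).1 ((hB ⟨x, hx, rfl⟩).trans (le_max_left _ _))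
    linarith

theorem transfer_infDist_le (hf : IsLocalHomeomorph f) {Z : Set M} (hZ : IsClosed Z)
    (hZne : Z.Nonempty) (hZf : f ⁻¹' Z ⊆ Z) {c : ℝ≥0}
    (hLip : LipschitzWith c (fibreSum f (Metric.infDist · Z))) {r : ℝ} (hr0 : 0 ≤ r)
    (hr : ∀ x, ρ x ≤ r) (y : M) :
    transfer f ρ (Metric.infDist · Z) y ≤ r * c * Metric.infDist y Z := by
  obtain ⟨z, hz, hyz⟩ := hZ.isCompact.exists_infDist_eq_dist hZne y
  have hz0 : fibreSum f (Metric.infDist · Z) z = 0 := by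
    rw [fibreSum_eq_sum (finite_fibre hf z)]
    refine Finset.sum_eq_zero fun x hx => Metric.infDist_zero_of_mem (hZf ?_)
    rw [Finite.mem_toFinset] at hx
    exact mem_preimage.2 (hx ▸ hz)
  calc transfer f ρ (Metric.infDist · Z) y ≤ fibreSum f (fun x => r * Metric.infDist x Z) y :=
        fibreSum_mono (finite_fibre hf y) fun x _ =>
          mul_le_mul_of_nonneg_right (hr x) Metric.infDist_nonneg
    _ = r * fibreSum f (Metric.infDist · Z) y := fibreSum_const_mul (finite_fibre hf y) _ _
    _ ≤ r * dist (fibreSum f (Metric.infDist · Z) y) (fibreSum f (Metric.infDist · Z) z) := by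
        rw [hz0, dist_zero_right]
        gcongr
        exact Real.le_norm_self _
    _ ≤ r * (c * dist y z) := by gcongr; exact hLip.dist_le_mul y z
    _ = r * c * Metric.infDist y Z := by rw [hyz, mul_assoc]

theorem eqOn_const_of_transfer_eq (hf : IsLocalHomeomorph f) (hρ : ∀ x, 0 < ρ x)
    (hS : IsClosed S) (hSne : S.Nonempty) (hSf : f ⁻¹' S ⊆ S)
    (hρ1 : ∀ y ∈ S, fibreSum f ρ y = 1) {c : ℝ≥0}
    (hLip : ∀ u : M → ℝ, LipschitzWith 1 u → LipschitzWith c (fibreSum f u))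
    {r : ℝ} (hr : ∀ x, ρ x ≤ r) (hrc : r * c < 1) {φ : M → ℝ} (hφ : Continuous φ)
    (hfix : ∀ y ∈ S, transfer f ρ φ y = φ y) : ∃ a, ∀ y ∈ S, φ y = a := by
  have hfin := finite_fibre hf
  obtain ⟨p, hpS, hp⟩ := hS.isCompact.exists_isMaxOn hSne hφ.continuousOn
  have hr0 : 0 ≤ r := (hρ p).le.trans (hr p)
  let w : M → ℝ := fun x => φ p + -1 * φ x
  have hwc : Continuous w := by fun_prop
  have hw0 : ∀ x ∈ S, 0 ≤ w x := fun x hx => by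
    simpa [w, neg_add_eq_sub] using hp hx
  have hwfix : ∀ y ∈ S, transfer f ρ w y = w y := fun y hy => by
    rw [transfer_const_add_mul (hfin y), hρ1 y hy, hfix y hy, mul_one]
  let Z : Set M := {x ∈ S | w x = 0}
  have hZ : IsClosed Z := hS.inter (isClosed_eq hwc continuous_const)
  have hZne : Z.Nonempty := ⟨p, hpS, by ring⟩
  have hZf : f ⁻¹' Z ⊆ Z := preimage_zeros_subset_of_transfer_eq hfin hρ hSf hw0 hwfix
  have hcontr := transfer_infDist_le hf hZ hZne hZf (hLip _ (Metric.lipschitz_infDist_pt Z)) hr0 hr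
  have hw : ∀ y ∈ S, ∀ η > 0, w y ≤ η := fun y hy η hη => by
    obtain ⟨k, hk, hwk⟩ := exists_le_add_mul_infDist hZ hZne hwc (fun z hz => hz.2.le) hη
    exact le_of_transfer_eq_of_le_add_mul hfin (fun x => (hρ x).le) hSf hρ1 hwfix
      (by positivity) hrc (fun y _ => hcontr y) hk (fun y _ => hwk y) hy
  refine ⟨φ p, fun y hy => ?_⟩
  have hwy : φ p + -1 * φ y = 0 := (le_of_forall_gt_imp_ge_of_dense (hw y hy)).antisymm (hw0 y hy)
  linarith

end TransferOperator

/-! ### Change of variables on the fibres -/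

section AreaFormula

variable {M : Type*} [MeasurableSpace M] {f : M → M}

/-- The counting measure on the fibre of `f` above a point. -/
def fibreCount (f : M → M) (y : M) : Measure M := Measure.count.restrict (f ⁻¹' {y})

theorem lintegral_fibreCount_ofReal [MeasurableSingletonClass M] {y : M}
    (hy : (f ⁻¹' {y}).Finite) {g : M → ℝ} (hg : ∀ x, 0 ≤ g x) :
    ∫⁻ x, ENNReal.ofReal (g x) ∂fibreCount f y = ENNReal.ofReal (fibreSum f g y) := by
  have hcount : fibreCount f y = Measure.count.restrict (hy.toFinset : Set M) := by
    rw [fibreCount, hy.coe_toFinset]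
  rw [fibreSum_eq_sum hy, ENNReal.ofReal_sum_of_nonneg fun x _ => hg x, hcount, lintegral_finset]
  simp only [Measure.count_singleton, mul_one]

theorem fibreCount_apply_of_injOn [MeasurableSingletonClass M] {A : Set M} (hA : MeasurableSet A)
    (hinj : InjOn f A) (y : M) : fibreCount f y A = (f '' A).indicator 1 y := by
  rw [fibreCount, Measure.restrict_apply hA]
  by_cases hy : y ∈ f '' A
  · obtain ⟨x, hx, rfl⟩ := hy
    have hfibre : A ∩ f ⁻¹' {f x} = {x} :=
      Subset.antisymm (fun x' hx' => hinj hx'.1 hx hx'.2) (singleton_subset_iff.2 ⟨hx, rfl⟩)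
    rw [hfibre, Measure.count_singleton, indicator_of_mem (mem_image_of_mem f hx), Pi.one_apply]
  · have hfibre : A ∩ f ⁻¹' {y} = ∅ :=
      eq_empty_of_forall_notMem fun x hx => hy ⟨x, hx.1, hx.2⟩
    rw [hfibre, measure_empty, indicator_of_notMem hy]

variable [TopologicalSpace M] [SecondCountableTopology M] [BorelSpace M]

theorem exists_measurable_partition_injOn (hf : IsLocalHomeomorph f) :
    ∃ D : ℕ → Set M, (∀ n, MeasurableSet (D n)) ∧ Pairwise (Function.onFun Disjoint D) ∧
      ⋃ n, D n = univ ∧ ∀ n, InjOn f (D n) := by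
  choose e hxe hfe using hf
  obtain ⟨s, hs, hcover⟩ := TopologicalSpace.countable_cover_nhds fun x =>
    (e x).open_source.mem_nhds (hxe x)
  rcases s.eq_empty_or_nonempty with rfl | hne
  · refine ⟨fun _ => ∅, fun _ => .empty, fun _ _ _ => disjoint_empty _, ?_, fun _ => injOn_empty f⟩
    simpa using hcover
  · obtain ⟨x, rfl⟩ := hs.exists_eq_range hne
    refine ⟨disjointed fun n => (e (x n)).source,
      fun _ => .disjointed (fun n => (e (x n)).open_source.measurableSet) _,
      disjoint_disjointed _, ?_, fun n => ?_⟩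
    · rw [iUnion_disjointed, ← hcover, biUnion_range]
    · rw [hfe (x n)]
      exact (e (x n)).injOn.mono (disjointed_subset _ n)

theorem exists_fibreCount_apply_eq_tsum [MeasurableSingletonClass M] (hf : IsLocalHomeomorph f)
    {B : Set M} (hB : MeasurableSet B) :
    ∃ D : ℕ → Set M, (∀ n, MeasurableSet (D n)) ∧ Pairwise (Function.onFun Disjoint D) ∧
      (∀ n, InjOn f (D n)) ∧ ⋃ n, D n = B ∧
      ∀ y, fibreCount f y B = ∑' n, (f '' D n).indicator 1 y := by
  obtain ⟨D, hD, hdisj, hcover, hinj⟩ := exists_measurable_partition_injOn hf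
  have hBD : ⋃ n, B ∩ D n = B := by rw [← inter_iUnion, hcover, inter_univ]
  have hBdisj : Pairwise (Function.onFun Disjoint fun n => B ∩ D n) := fun i j hij =>
    (hdisj hij).mono inter_subset_right inter_subset_right
  have hBinj : ∀ n, InjOn f (B ∩ D n) := fun n => (hinj n).mono inter_subset_right
  refine ⟨fun n => B ∩ D n, fun n => hB.inter (hD n), hBdisj, hBinj, hBD, fun y => ?_⟩
  conv_lhs => rw [← hBD, measure_iUnion hBdisj fun n => hB.inter (hD n)]
  exact tsum_congr fun n => fibreCount_apply_of_injOn (hB.inter (hD n)) (hBinj n) y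

variable [StandardBorelSpace M]

theorem measurable_fibreCount (hf : IsLocalHomeomorph f) : Measurable (fibreCount f) := by
  refine Measure.measurable_of_measurable_coe _ fun B hB => ?_
  obtain ⟨D, hD, -, hinj, -, hsum⟩ := exists_fibreCount_apply_eq_tsum hf hB
  simp only [hsum]
  exact .tsum fun n => measurable_one.indicator
    ((hD n).image_of_measurable_injOn hf.continuous.measurable (hinj n))

variable {m : Measure M} {J : M → ℝ}

theorem IsJacobian.bind_fibreCount (hJ : IsJacobian f m J) (hf : IsLocalHomeomorph f) :
    m.bind (fibreCount f) = m.withDensity fun x => ENNReal.ofReal (J x) := by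
  ext B hB
  obtain ⟨D, hD, hdisj, hinj, hDB, hsum⟩ := exists_fibreCount_apply_eq_tsum hf hB
  have himage : ∀ n, MeasurableSet (f '' D n) := fun n =>
    (hD n).image_of_measurable_injOn hf.continuous.measurable (hinj n)
  calc m.bind (fibreCount f) B = ∫⁻ y, ∑' n, (f '' D n).indicator 1 y ∂m := by
        rw [Measure.bind_apply hB (measurable_fibreCount hf).aemeasurable]
        simp only [hsum]
    _ = ∑' n, m (f '' D n) := by
        rw [lintegral_tsum fun n => (measurable_one.indicator (himage n)).aemeasurable]
        exact tsum_congr fun n => lintegral_indicator_one (himage n)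
    _ = ∑' n, ∫⁻ x in D n, ENNReal.ofReal (J x) ∂m :=
        tsum_congr fun n => hJ.image _ (hD n) (hinj n)
    _ = (m.withDensity fun x => ENNReal.ofReal (J x)) B := by
        rw [← lintegral_iUnion hD hdisj, hDB, withDensity_apply _ hB]

theorem IsJacobian.map_withDensity_mul (hJ : IsJacobian f m J) (hf : IsLocalHomeomorph f)
    {g : M → ℝ≥0∞} (hg : Measurable g) :
    (m.withDensity fun x => g x * ENNReal.ofReal (J x)).map f =
      m.withDensity fun y => ∫⁻ x, g x ∂fibreCount f y := by
  have hfm := hf.continuous.measurable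
  ext B hB
  have hfibre : ∀ y, ∫⁻ x, (f ⁻¹' B).indicator g x ∂fibreCount f y =
      B.indicator (fun y => ∫⁻ x, g x ∂fibreCount f y) y := fun y => by
    have hmem : ∀ᵐ x ∂fibreCount f y, f x = y :=
      ae_restrict_mem (hfm (measurableSet_singleton y))
    by_cases hy : y ∈ B
    · rw [indicator_of_mem hy]
      refine lintegral_congr_ae (hmem.mono fun x hx => indicator_of_mem ?_ _)
      exact mem_preimage.2 (hx ▸ hy)
    · rw [indicator_of_notMem hy, ← lintegral_zero (μ := fibreCount f y)]
      refine lintegral_congr_ae (hmem.mono fun x hx => indicator_of_notMem ?_ _)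
      exact fun hxB => hy (hx ▸ mem_preimage.1 hxB)
  calc (m.withDensity fun x => g x * ENNReal.ofReal (J x)).map f B
      = ∫⁻ x in f ⁻¹' B, g x * ENNReal.ofReal (J x) ∂m := by
        rw [Measure.map_apply hfm hB, withDensity_apply _ (hfm hB)]
    _ = ∫⁻ x, (f ⁻¹' B).indicator g x ∂m.withDensity fun x => ENNReal.ofReal (J x) := by
        rw [lintegral_indicator (hfm hB), setLIntegral_withDensity_eq_setLIntegral_mul _
          hJ.measurable.ennreal_ofReal hg (hfm hB)]
        simp only [Pi.mul_apply, mul_comm]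
    _ = ∫⁻ y, ∫⁻ x, (f ⁻¹' B).indicator g x ∂fibreCount f y ∂m := by
        rw [← hJ.bind_fibreCount hf, Measure.lintegral_bind (measurable_fibreCount hf).aemeasurable
          (hg.indicator (hfm hB)).aemeasurable]
    _ = (m.withDensity fun y => ∫⁻ x, g x ∂fibreCount f y) B := by
        simp only [hfibre]
        rw [lintegral_indicator hB, withDensity_apply _ hB]

end AreaFormula

section Support

variable {M : Type*} [TopologicalSpace M] [MeasurableSpace M] [BorelSpace M] {f : M → M}
  {m : Measure M} {J : M → ℝ}

theorem IsJacobian.preimage_support_subset (hJ : IsJacobian f m J) (hf : IsLocalHomeomorph f) :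
    f ⁻¹' m.support ⊆ m.support := by
  intro x hx
  rw [Measure.mem_support_iff_forall]
  intro U hU
  obtain ⟨e, hxe, rfl⟩ := hf x
  let W := interior U ∩ e.source
  have hW : IsOpen W := isOpen_interior.inter e.open_source
  have hxW : x ∈ W := ⟨mem_interior_iff_mem_nhds.2 hU, hxe⟩
  have hpos : 0 < m (e '' W) := (Measure.mem_support_iff_forall _).1 hx (e '' W)
    ((hf.isOpenMap W hW).mem_nhds ⟨x, hxW, rfl⟩)
  rw [hJ.image W hW.measurableSet (e.injOn.mono inter_subset_right)] at hpos
  refine pos_iff_ne_zero.2 fun h0 => hpos.ne' ?_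
  exact setLIntegral_measure_zero _ _
    (measure_mono_null (inter_subset_left.trans interior_subset) h0)

theorem IsJacobian.transfer_eq_on_support [CompactSpace M] [T2Space M]
    [SecondCountableTopology M] [StandardBorelSpace M] [IsFiniteMeasure m]
    (hJ : IsJacobian f m J) (hf : IsLocalHomeomorph f)
    {ρ : M → ℝ} (hρ : Continuous ρ) (hρ0 : ∀ x, 0 ≤ ρ x) (hρJ : ∀ x, ρ x * J x = 1)
    {φ : M → ℝ} (hφ : Continuous φ) (hφ0 : ∀ x, 0 ≤ φ x)
    (hinv : (m.withDensity fun x => ENNReal.ofReal (φ x)).map f =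
      m.withDensity fun x => ENNReal.ofReal (φ x)) :
    ∀ y ∈ m.support, transfer f ρ φ y = φ y := by
  have hρφ : Continuous fun x => ρ x * φ x := hρ.mul hφ
  have hρφ0 : ∀ x, 0 ≤ ρ x * φ x := fun x => mul_nonneg (hρ0 x) (hφ0 x)
  have hdensity : ∀ x, ENNReal.ofReal (ρ x * φ x) * ENNReal.ofReal (J x) =
      ENNReal.ofReal (φ x) := fun x => by
    rw [← ENNReal.ofReal_mul (hρφ0 x), mul_right_comm, hρJ, one_mul]
  have hmap := hJ.map_withDensity_mul hf hρφ.measurable.ennreal_ofReal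
  simp only [hdensity, lintegral_fibreCount_ofReal (finite_fibre hf _) hρφ0] at hmap
  have htransfer : Continuous (transfer f ρ φ) := continuous_fibreSum hf hρφ
  have hae : ∀ᵐ y ∂m, ENNReal.ofReal (transfer f ρ φ y) = ENNReal.ofReal (φ y) :=
    (withDensity_eq_iff_of_sigmaFinite htransfer.measurable.ennreal_ofReal.aemeasurable
      hφ.measurable.ennreal_ofReal.aemeasurable).1 (hmap.symm.trans hinv)
  refine Measure.support_subset_of_isClosed (isClosed_eq htransfer hφ) (hae.mono fun y hy => ?_)
  refine (ENNReal.ofReal_eq_ofReal_iff ?_ (hφ0 y)).1 hy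
  rw [transfer, fibreSum_eq_sum (finite_fibre hf y)]
  exact Finset.sum_nonneg fun x _ => hρφ0 x

end Support

/-! ### The marginal of an invariant measure -/

section Weight

variable {M : Type*} [MetricSpace M] {ζ : ℝ≥0} {ρ : M → ℝ} {ε : ℝ}

theorem CondF3.continuous (h : CondF3 ζ ρ ε) (hζ : 0 < ζ) : Continuous ρ :=
  (eHolderNorm_lt_top.1 (h.2.trans ENNReal.ofReal_lt_top)).holderWith.continuous hζ

theorem CondF3.pos (h : CondF3 ζ ρ ε) (hρ : ∀ x, 0 ≤ ρ x) (x : M) : 0 < ρ x := by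
  have hmul : 0 < ε * ⨅ x, ρ x := ENNReal.ofReal_pos.1 (zero_le.trans_lt h.2)
  have hinf : 0 < ⨅ x, ρ x :=
    (Real.iInf_nonneg hρ).lt_of_ne fun h0 => by rw [← h0, mul_zero] at hmul; exact hmul.false
  exact hinf.trans_le (ciInf_le ⟨0, forall_mem_range.2 hρ⟩ x)

variable [CompactSpace M]

theorem CondF3.le_exp_mul (h : CondF3 ζ ρ ε) (hζ : 0 < ζ) (hρ : ∀ x, 0 ≤ ρ x) (x y : M) :
    ρ x ≤ Real.exp ε * ρ y := by
  have hpos := h.pos hρ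
  have hcompact := isCompact_range ((h.continuous hζ).log fun x => (hpos x).ne')
  have hsup := le_ciSup hcompact.bddAbove x
  have hinf := ciInf_le hcompact.bddBelow y
  have hlog : Real.log (ρ x) ≤ ε + Real.log (ρ y) := by linarith [h.1]
  calc ρ x = Real.exp (Real.log (ρ x)) := (Real.exp_log (hpos x)).symm
    _ ≤ Real.exp (ε + Real.log (ρ y)) := Real.exp_le_exp.2 hlog
    _ = Real.exp ε * ρ y := by rw [Real.exp_add, Real.exp_log (hpos y)]

theorem le_div_mapDegree_of_fibreSum_eq_one [PreconnectedSpace M] [Nonempty M] {f : M → M}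
    (hf : IsLocalHomeomorph f) (hd : 0 < mapDegree f) {r : ℝ} {x y : M}
    (hρ : ∀ x', ρ x ≤ r * ρ x') (hy : fibreSum f ρ y = 1) : ρ x ≤ r / mapDegree f := by
  have hfin := finite_fibre hf y
  have hcard : hfin.toFinset.card = mapDegree f := by
    rw [← ncard_eq_toFinset_card _ hfin, mapDegree, ncard_fibre_eq hf y]
  rw [fibreSum_eq_sum hfin] at hy
  rw [le_div_iff₀ (Nat.cast_pos.2 hd)]
  calc ρ x * mapDegree f = ∑ _x' ∈ hfin.toFinset, ρ x := by
        rw [Finset.sum_const, nsmul_eq_mul, hcard, mul_comm]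
    _ ≤ ∑ x' ∈ hfin.toFinset, r * ρ x' := Finset.sum_le_sum fun x' _ => hρ x'
    _ = r := by rw [← Finset.mul_sum, hy, mul_one]

end Weight

section Base

theorem eq_withDensity_ofReal_of_rnDeriv_ae_eq {X : Type*} [MeasurableSpace X] {m η : Measure X}
    [SigmaFinite m] [SigmaFinite η] (hac : η ≪ m) {h : X → ℝ}
    (hdens : (fun x => (η.rnDeriv m x).toReal) =ᵐ[m] h) :
    η = m.withDensity fun x => ENNReal.ofReal (h x) := by
  conv_lhs => rw [← Measure.withDensity_rnDeriv_eq η m hac]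
  refine withDensity_congr_ae ?_
  filter_upwards [hdens, Measure.rnDeriv_lt_top η m] with x hx hlt
  rw [← hx, ENNReal.ofReal_toReal hlt.ne]

theorem eq_of_eqOn_support_const {X : Type*} [TopologicalSpace X] [HereditarilyLindelofSpace X]
    [MeasurableSpace X] {m η : Measure X} [IsProbabilityMeasure m] [IsProbabilityMeasure η]
    {φ : X → ℝ≥0∞} (hη : η = m.withDensity φ) {a : ℝ≥0∞} (ha : ∀ y ∈ m.support, φ y = a) :
    η = m := by
  have hηa : η = a • m := by
    rw [hη, ← withDensity_const]
    exact withDensity_congr_ae (mem_of_superset Measure.support_mem_ae ha)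
  have ha1 : a = 1 := by
    simpa only [Measure.smul_apply, measure_univ, smul_eq_mul, mul_one] using
      (congrArg (fun κ : Measure X => κ univ) hηa).symm
  rw [hηa, ha1, one_smul]

variable {M : Type*} [MetricSpace M] [CompactSpace M] [MeasurableSpace M] [BorelSpace M]
  {f : M → M} {m : Measure M} {J ρ : M → ℝ}

theorem IsJacobian.fibreSum_eq_one_on_support [IsFiniteMeasure m] (hJ : IsJacobian f m J)
    (hf : IsLocalHomeomorph f) (hm : m.map f = m) (hρ : Continuous ρ) (hρ0 : ∀ x, 0 ≤ ρ x)
    (hρJ : ∀ x, ρ x * J x = 1) : ∀ y ∈ m.support, fibreSum f ρ y = 1 := by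
  have h := hJ.transfer_eq_on_support hf hρ hρ0 hρJ (φ := fun _ => 1) continuous_const
    (fun _ => zero_le_one) (by simpa only [ENNReal.ofReal_one, withDensity_const, one_smul])
  simpa only [transfer, mul_one] using h

theorem eq_of_continuous_rnDeriv [IsProbabilityMeasure m] (hf : IsLocalHomeomorph f)
    (hm : m.map f = m) (hJ : IsJacobian f m J)
    (hρ : Continuous ρ) (hρ0 : ∀ x, 0 < ρ x) (hρJ : ∀ x, ρ x * J x = 1)
    {c : ℝ≥0} (hLip : ∀ u, LipschitzWith 1 u → LipschitzWith c (fibreSum f u))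
    {r : ℝ} (hr : ∀ x, ρ x ≤ r) (hrc : r * c < 1)
    {η : Measure M} [IsProbabilityMeasure η] (hη : η.map f = η) (hac : η ≪ m)
    {h : M → ℝ} (hh : Continuous h) (hdens : (fun x => (η.rnDeriv m x).toReal) =ᵐ[m] h) :
    η = m := by
  have hρ0' : ∀ x, 0 ≤ ρ x := fun x => (hρ0 x).le
  let φ : M → ℝ := fun x => max (h x) 0
  have hφ : Continuous φ := hh.max continuous_const
  have hηφ : η = m.withDensity fun x => ENNReal.ofReal (φ x) := by
    refine eq_withDensity_ofReal_of_rnDeriv_ae_eq hac (hdens.mono fun x hx => ?_)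
    rw [hx, eq_comm]
    exact max_eq_left (hx ▸ ENNReal.toReal_nonneg)
  have hfix : ∀ y ∈ m.support, transfer f ρ φ y = φ y :=
    hJ.transfer_eq_on_support hf hρ hρ0' hρJ hφ (fun x => le_max_right _ _) (by rw [← hηφ, hη])
  obtain ⟨a, ha⟩ := eqOn_const_of_transfer_eq hf hρ0 Measure.isClosed_support
    (Measure.nonempty_support (IsProbabilityMeasure.ne_zero m)) (hJ.preimage_support_subset hf)
    (hJ.fibreSum_eq_one_on_support hf hm hρ hρ0' hρJ) hLip hr hrc hφ hfix
  exact eq_of_eqOn_support_const hηφ fun y hy => congrArg ENNReal.ofReal (ha y hy)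

theorem eq_of_continuous_rnDeriv_of_condF1_of_condF2_of_condF3 [Nonempty M] (hM : IsLengthSpace M)
    {ζ : ℝ≥0} (hζ0 : 0 < ζ) (hζ1 : ζ ≤ 1) (hf : IsLocalHomeomorph f)
    [IsProbabilityMeasure m] (hm : m.map f = m) (hJ : IsJacobian f m J)
    {L : M → ℝ} (hL : LocalInverseLipschitz f L) {A : Set M} {σ Λ ε : ℝ} {q : ℕ}
    (hσ : 1 ≤ σ) (hΛ1 : 1 ≤ Λ) (hΛ2 : Λ ≤ 2) (hf1 : CondF1 L A σ Λ) (hf2 : CondF2 f A q)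
    (hf3 : CondF3 ζ (fun x => 1 / |J x|) ε) (hconst : CondConstants ζ (mapDegree f) q σ Λ ε)
    {η : Measure M} [IsProbabilityMeasure η] (hη : η.map f = η) (hac : η ≪ m)
    {h : M → ℝ} (hh : Continuous h) (hdens : (fun x => (η.rnDeriv m x).toReal) =ᵐ[m] h) :
    η = m := by
  have := hM.pathConnectedSpace
  have hρ0 : ∀ x, 0 ≤ 1 / |J x| := fun x => one_div_nonneg.2 (abs_nonneg _)
  have hρ := hf3.continuous hζ0
  have hρpos := hf3.pos hρ0
  have hρJ : ∀ x, 1 / |J x| * J x = 1 := fun x => by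
    have hJ0 : |J x| ≠ 0 := (one_div_pos.1 (hρpos x)).ne'
    rw [← abs_of_nonneg (hJ.nonneg x), abs_abs, one_div_mul_cancel hJ0]
  obtain ⟨y, hy⟩ : m.support.Nonempty :=
    Measure.nonempty_support (IsProbabilityMeasure.ne_zero m)
  have hr : ∀ x, 1 / |J x| ≤ Real.exp ε / mapDegree f := fun x =>
    le_div_mapDegree_of_fibreSum_eq_one hf (q.zero_le.trans_lt hf2.1)
      (hf3.le_exp_mul hζ0 hρ0 x) (hJ.fibreSum_eq_one_on_support hf hm hρ hρ0 hρJ y hy)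
  have hq : (0 : ℝ) ≤ mapDegree f - q := sub_nonneg.2 (Nat.cast_le.2 hf2.1.le)
  let c : ℝ≥0 := ⟨((mapDegree f : ℝ) - q) * σ⁻¹ + q * Λ, by positivity⟩
  have hLip : ∀ u, LipschitzWith 1 u → LipschitzWith c (fibreSum f u) := fun u =>
    lipschitzWith_fibreSum (c := c) hM hf hL
      (fibreSum_le_of_condF1_of_condF2 hf ((inv_le_one_of_one_le₀ hσ).trans hΛ1) hf1 hf2)
  exact eq_of_continuous_rnDeriv hf hm hJ hρ hρpos hρJ hLip hr
    (hconst.linear hζ1 hf2.1.le hσ hΛ1 hΛ2) hη hac hh hdens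

end Base

section Positive

theorem toJordanDecomposition_toSignedMeasure {X : Type*} [MeasurableSpace X] (μ : Measure X)
    [IsFiniteMeasure μ] :
    μ.toSignedMeasure.toJordanDecomposition.posPart = μ ∧
      μ.toSignedMeasure.toJordanDecomposition.negPart = 0 := by
  have h := Measure.toJordanDecomposition_toSignedMeasure_sub (μ := μ) (ν := 0)
  rw [Measure.toSignedMeasure_zero, sub_zero] at h
  rw [h]
  exact ⟨Measure.sub_zero, Measure.zero_sub⟩

theorem wDist_zero_right_le {K : Type*} [MetricSpace K] [MeasurableSpace K] (ζ : ℝ≥0)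
    (μ : Measure K) [IsFiniteMeasure μ] : wDist ζ μ 0 ≤ μ univ := by
  refine iSup_le fun g => iSup_le fun _ => iSup_le fun hg => ?_
  have hint : ‖∫ z, g z ∂μ‖ ≤ 1 * μ.real univ :=
    norm_integral_le_of_norm_le_const (ae_of_all _ hg)
  rw [integral_zero_measure, sub_zero, ← ofReal_measureReal]
  exact ENNReal.ofReal_le_ofReal (hint.trans_eq (one_mul _))

variable {M K : Type*} [MeasurableSpace M] [MeasurableSpace K] {m : Measure M}
  (μ : Measure (M × K)) [IsFiniteMeasure μ]

theorem toSignedMeasure_mem_AB_iff : μ.toSignedMeasure ∈ AB m ↔ μ.fst ≪ m := by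
  obtain ⟨hpos, hneg⟩ := toJordanDecomposition_toSignedMeasure μ
  rw [AB, mem_ofPred_eq, posM, negM, hpos, hneg, Measure.fst_zero]
  exact and_iff_left (Measure.AbsolutelyContinuous.zero m)

theorem marginalDensity_toSignedMeasure :
    marginalDensity m μ.toSignedMeasure =ᵐ[m] fun x => (μ.fst.rnDeriv m x).toReal := by
  obtain ⟨hpos, hneg⟩ := toJordanDecomposition_toSignedMeasure μ
  filter_upwards [Measure.rnDeriv_zero m] with x hx
  rw [marginalDensity, posM, negM, hpos, hneg, Measure.fst_zero, hx, Pi.zero_apply,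
    ENNReal.toReal_zero, sub_zero]

variable [MetricSpace K] [StandardBorelSpace K] [Nonempty K]

theorem wDist_fibreRestriction_toSignedMeasure_le (ζ : ℝ≥0) :
    ∀ᵐ x ∂m, wDist ζ (fibreRestriction m (posM μ.toSignedMeasure) x)
      (fibreRestriction m (negM μ.toSignedMeasure) x) ≤ μ.fst.rnDeriv m x := by
  obtain ⟨hpos, hneg⟩ := toJordanDecomposition_toSignedMeasure μ
  have hnegFst : (negM μ.toSignedMeasure).fst = 0 := by rw [negM, hneg, Measure.fst_zero]
  filter_upwards [Measure.rnDeriv_zero m, Measure.rnDeriv_lt_top μ.fst m] with x hx0 hxlt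
  have hnegRestr : fibreRestriction m (negM μ.toSignedMeasure) x = 0 := by
    rw [fibreRestriction, hnegFst, hx0, Pi.zero_apply, zero_smul]
  have hmass : fibreRestriction m (posM μ.toSignedMeasure) x univ = μ.fst.rnDeriv m x := by
    rw [fibreRestriction, Measure.smul_apply, measure_univ, smul_eq_mul, mul_one, posM, hpos]
  have : IsFiniteMeasure (fibreRestriction m (posM μ.toSignedMeasure) x) := ⟨hmass ▸ hxlt⟩
  exact hnegRestr ▸ (wDist_zero_right_le ζ _).trans hmass.le

theorem toSignedMeasure_mem_SInfty_of_fst_eq [MetricSpace M] [SigmaFinite m] (hμ : μ.fst = m)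
    (ζ : ℝ≥0) :
    μ.toSignedMeasure ∈ SInfty m ζ := by
  have hdens : μ.fst.rnDeriv m =ᵐ[m] fun _ => 1 := by rw [hμ]; exact Measure.rnDeriv_self m
  refine ⟨⟨(toSignedMeasure_mem_AB_iff μ).2 hμ.absolutelyContinuous, ?_⟩, fun _ => 1,
    ⟨0, HolderWith.const⟩, ?_⟩
  · refine (essSup_le_of_ae_le 1 ?_).trans_lt ENNReal.one_lt_top
    filter_upwards [wDist_fibreRestriction_toSignedMeasure_le μ ζ, hdens] with x hx hx1
    exact hx.trans hx1.le
  · filter_upwards [marginalDensity_toSignedMeasure (m := m) μ, hdens] with x hx hx1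
    rw [hx, hx1, ENNReal.toReal_one]

theorem exists_continuous_rnDeriv_of_toSignedMeasure_mem_SInfty [MetricSpace M] {ζ : ℝ≥0}
    (hζ : 0 < ζ) (hμ : μ.toSignedMeasure ∈ SInfty m ζ) :
    μ.fst ≪ m ∧ ∃ h : M → ℝ, Continuous h ∧ (fun x => (μ.fst.rnDeriv m x).toReal) =ᵐ[m] h := by
  obtain ⟨⟨hAB, -⟩, h, ⟨C, hC⟩, hdens⟩ := hμ
  exact ⟨(toSignedMeasure_mem_AB_iff μ).1 hAB, h, hC.continuous hζ,
    (marginalDensity_toSignedMeasure μ).symm.trans hdens⟩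

end Positive

end SkewProduct

end

theorem theoremA_general
    {M : Type*} [MetricSpace M] [CompactSpace M] [Nonempty M] [MeasurableSpace M] [BorelSpace M]
    (hM : SkewProduct.IsLengthSpace M)
    {K : Type*} [MetricSpace K] [CompactSpace K] [Nonempty K] [MeasurableSpace K] [BorelSpace K]
    (ζ : ℝ≥0) (hζ0 : 0 < ζ) (hζ1 : ζ ≤ 1)
    (f : M → M) (hf : IsLocalHomeomorph f)
    (m₁ : Measure M) [IsProbabilityMeasure m₁] (hm₁ : MeasurePreserving f m₁ m₁)
    (J : M → ℝ) (hJ : SkewProduct.IsJacobian f m₁ J)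
    (L : M → ℝ) (hL : SkewProduct.LocalInverseLipschitz f L)
    (A : Set M) (σ Λ ε : ℝ) (q : ℕ) (hσ : 1 ≤ σ) (hΛ1 : 1 ≤ Λ) (hΛ2 : Λ ≤ 2)
    (hf1 : SkewProduct.CondF1 L A σ Λ)
    (hf2 : SkewProduct.CondF2 f A q)
    (hf3 : SkewProduct.CondF3 ζ (fun x => 1 / |J x|) ε)
    (hconst : SkewProduct.CondConstants ζ (SkewProduct.mapDegree f) q σ Λ ε)
    (G : M × K → K) (hG : Measurable G) (hG1 : SkewProduct.CondG1 m₁ G) :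
    ∃ μ₀ : ProbabilityMeasure (M × K),
      (MeasurePreserving (SkewProduct.skew f G) (μ₀ : Measure (M × K)) (μ₀ : Measure (M × K)) ∧
        (μ₀ : Measure (M × K)).toSignedMeasure ∈ SkewProduct.SInfty m₁ ζ) ∧
      (∀ ν : ProbabilityMeasure (M × K),
        MeasurePreserving (SkewProduct.skew f G) (ν : Measure (M × K)) (ν : Measure (M × K)) →
        (ν : Measure (M × K)).toSignedMeasure ∈ SkewProduct.SInfty m₁ ζ → ν = μ₀) ∧
      Measure.map Prod.fst (μ₀ : Measure (M × K)) = m₁ := by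
  obtain ⟨μ₀, ⟨hμ₀, hμ₀fst⟩, hunique⟩ :=
    SkewProduct.existsUnique_measurePreserving_skew hm₁ hG hG1
  refine ⟨μ₀, ⟨hμ₀, SkewProduct.toSignedMeasure_mem_SInfty_of_fst_eq _ hμ₀fst ζ⟩,
    fun ν hν hνS => hunique ν ⟨hν, ?_⟩, hμ₀fst⟩
  obtain ⟨hac, h, hh, hdens⟩ :=
    SkewProduct.exists_continuous_rnDeriv_of_toSignedMeasure_mem_SInfty _ hζ0 hνS
  exact SkewProduct.eq_of_continuous_rnDeriv_of_condF1_of_condF2_of_condF3 hM hζ0 hζ1 hf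
    hm₁.map_eq hJ hL hσ hΛ1 hΛ2 hf1 hf2 hf3 hconst
    (SkewProduct.map_fst_eq_of_measurePreserving_skew hm₁.measurable hν) hac hh hdens

theorem theoremA
    -- a compact connected Riemannian manifold `M` with its Riemannian distance
    {E : Type*} [NormedAddCommGroup E] [InnerProductSpace ℝ E] [FiniteDimensional ℝ E]
    {M : Type*} [MetricSpace M] [ChartedSpace E M] [IsManifold 𝓘(ℝ, E) ∞ M]
    [Bundle.RiemannianBundle (fun x : M => TangentSpace 𝓘(ℝ, E) x)]
    [IsContMDiffRiemannianBundle 𝓘(ℝ, E) ∞ E (fun x : M => TangentSpace 𝓘(ℝ, E) x)]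
    [IsRiemannianManifold 𝓘(ℝ, E) M]
    [CompactSpace M] [ConnectedSpace M] [MeasurableSpace M] [BorelSpace M]
    -- a compact metric space `K`
    {K : Type*} [MetricSpace K] [CompactSpace K] [Nonempty K] [MeasurableSpace K] [BorelSpace K]
    -- the Hölder exponent
    (ζ : ℝ≥0) (hζ0 : 0 < ζ) (hζ1 : ζ ≤ 1)
    -- the base map and its invariant probability `m₁`, with Jacobian `J`
    (f : M → M) (hf : IsLocalDiffeomorph 𝓘(ℝ, E) 𝓘(ℝ, E) 1 f)
    (m₁ : Measure M) [IsProbabilityMeasure m₁] (hm₁ : MeasurePreserving f m₁ m₁)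
    (J : M → ℝ) (hJ : SkewProduct.IsJacobian f m₁ J)
    -- the hypotheses on `f`, where `Λ` is the constant bounding `L` on `A`
    (L : M → ℝ) (hLcont : Continuous L) (hL : SkewProduct.LocalInverseLipschitz f L)
    (A : Set M) (hA : IsOpen A) (σ Λ ε : ℝ) (q : ℕ)
    (hσ : 1 < σ) (hΛ1 : 1 ≤ Λ) (hΛ2 : Λ ≤ 2) (hε : 0 < ε)
    (hf1 : SkewProduct.CondF1 L A σ Λ)
    (hf2 : SkewProduct.CondF2 f A q)
    (hf3 : SkewProduct.CondF3 ζ (fun x => 1 / |J x|) ε)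
    (hconst : SkewProduct.CondConstants ζ (SkewProduct.mapDegree f) q σ Λ ε)
    -- the fibre map
    (G : M × K → K) (hG : Measurable G) (hG1 : SkewProduct.CondG1 m₁ G) :
    ∃ μ₀ : ProbabilityMeasure (M × K),
      (MeasurePreserving (SkewProduct.skew f G) (μ₀ : Measure (M × K)) (μ₀ : Measure (M × K)) ∧
        (μ₀ : Measure (M × K)).toSignedMeasure ∈ SkewProduct.SInfty m₁ ζ) ∧
      (∀ ν : ProbabilityMeasure (M × K),
        MeasurePreserving (SkewProduct.skew f G) (ν : Measure (M × K)) (ν : Measure (M × K)) →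
        (ν : Measure (M × K)).toSignedMeasure ∈ SkewProduct.SInfty m₁ ζ → ν = μ₀) ∧
      Measure.map Prod.fst (μ₀ : Measure (M × K)) = m₁ :=
  theoremA_general (SkewProduct.isLengthSpace_of_isRiemannianManifold E M) ζ hζ0 hζ1 f
    hf.isLocalHomeomorph m₁ hm₁ J hJ L hL A σ Λ ε q hσ.le hΛ1 hΛ2 hf1 hf2 hf3 hconst G hG hG1
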